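/- **Proposition 3.1.** Let $n\ge 1$ and let $a_0,\dots,a_n$ be i.i.d. standard complex Gaussian random variables (mean $0$, $\mathbb E|a_j|^2=1$, i.e. with density $\pi^{-1}e^{-|z|^2}$ with respect to Lebesgue measure on $\mathbb C$). Let $$p_n(z)=\sum_{j=0}^n a_j\sqrt{\binom nj}\,z^j,\qquad \mathcal C_{p_n}=\sum_{z\in\mathbb C:\ p_n'(z)=0}\delta_{p_n(z)},\qquad \langle\mathcal C_{p_n},\phi\rangle=\sum_{z:\ p_n'(z)=0}\phi(p_n(z)),$$ where each critical point is counted once. A locally integrable function $D$ on $\mathbb C$ is called the expected density of $\mathcal C_{p_n}$ if, for every smooth compactly supported $\phi$ on $\mathbb C=\mathbb R^2$, the random variable $\langle\mathcal C_{p_n},\phi\rangle$ is integrable and $$\mathbb E\langle\mathcal C_{p_n},\phi\rangle=\int_{\mathbb C}\phi(x)\,D(x)\,d\ell_x ,$$ $d\ell_x$ being Lebesgue measure. Then the expected density $\mathbb D_{p_n}$ of $\mathcal C_{p_n}$ exists, is unique up to almost everywhere equality, and is given by $$\mathbb D_{p_n}(x)=\frac{n-1}{\pi}\int_1^\infty\frac{n(r-1)+1}{r^{n+2}}\,\exp\!\Big(-\frac{n(r-1)+1}{r^n}\,|x|^2\Big)\,dr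 ,$$ where the integral converges for every $x\in\mathbb C$. In particular $\mathbb D_{p_n}$ depends only on $|x|$. -/

import Mathlib

open MeasureTheory ProbabilityTheory Polynomial

namespace SU2

/-- The law of a standard complex Gaussian random variable (mean `0`, `𝔼|a|² = 1`): the measure on
`ℂ` with density `π⁻¹ exp (-|z|²)` with respect to Lebesgue measure. -/
noncomputable def stdComplexGaussian : Measure ℂ :=
  (volume : Measure ℂ).withDensity fun z => ENNReal.ofReal (Real.pi⁻¹ * Real.exp (-‖z‖ ^ 2))

/-- The polynomial `p_n(z) = ∑_{j=0}^n a_j √(n choose j) z^j` with coefficient vector `a`. -/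
noncomputable def poly (n : ℕ) (a : Fin (n + 1) → ℂ) : ℂ[X] :=
  ∑ j : Fin (n + 1), C (a j * (Real.sqrt (n.choose j : ℝ) : ℂ)) * X ^ (j : ℕ)

/-- The empirical measure `∑_{z : p'(z) = 0} δ_{p(z)}` of the critical values of `p`. -/
noncomputable def criticalValueMeasure (p : ℂ[X]) : Measure ℂ :=
  Measure.sum fun z : {z : ℂ // p.derivative.eval z = 0} => Measure.dirac (p.eval (z : ℂ))

/-- The pairing `⟨𝒞_p, φ⟩` of the empirical measure of critical values with a test function. -/
noncomputable def pairing (p : ℂ[X]) (φ : ℂ → ℂ) : ℂ :=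
  ∫ x, φ x ∂(criticalValueMeasure p)

/-- If `p' ≠ 0`, the pairing is the finite sum `∑_{z : p'(z) = 0} φ(p(z))`. -/
theorem pairing_eq_sum (p : ℂ[X]) (hp : p.derivative ≠ 0) (φ : ℂ → ℂ) :
    pairing p φ = ∑ z ∈ p.derivative.roots.toFinset, φ (p.eval z) := by
  have hmem : ∀ z : ℂ, z ∈ p.derivative.roots.toFinset ↔ p.derivative.eval z = 0 := by
    intro z
    rw [Multiset.mem_toFinset, mem_roots hp, IsRoot.def]
  have : Fintype {z : ℂ // p.derivative.eval z = 0} := Fintype.subtype _ hmem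
  rw [pairing, criticalValueMeasure, Measure.sum_fintype,
    integral_finsetSum_measure fun z _ => integrable_dirac (by simp)]
  simp only [integral_dirac]
  exact (Finset.sum_subtype _ hmem fun z => φ (p.eval z)).symm

/-- `D` is the expected density of the critical values of the random polynomial `p`:
`D` is locally integrable and, for every smooth compactly supported test function `φ` on `ℂ = ℝ²`,
the random variable `⟨𝒞_p, φ⟩` has a finite expectation, equal to `∫ φ(x) D(x) dℓ_x`. -/
def IsExpectedDensity {Ω : Type*} [MeasurableSpace Ω] (P : Measure Ω) (p : Ω → ℂ[X])
    (D : ℂ → ℝ) : Prop :=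
  LocallyIntegrable D volume ∧
    ∀ φ : ℂ → ℂ, ContDiff ℝ (⊤ : ℕ∞) φ → HasCompactSupport φ →
      Integrable (fun ω => pairing (p ω) φ) P ∧
        ∫ ω, pairing (p ω) φ ∂P = ∫ x, φ x * (D x : ℂ)

/-- The integrand `(n(r-1)+1) / r^{n+2} · exp (-(n(r-1)+1) |x|² / r^n)`. -/
noncomputable def densityIntegrand (n : ℕ) (x : ℂ) (r : ℝ) : ℝ :=
  ((n : ℝ) * (r - 1) + 1) / r ^ (n + 2) *
    Real.exp (-(((n : ℝ) * (r - 1) + 1) / r ^ n * ‖x‖ ^ 2))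

/-- `((n-1)/π) ∫_1^∞ (n(r-1)+1) / r^{n+2} · exp (-(n(r-1)+1) |x|² / r^n) dr`. -/
noncomputable def densityFormula (n : ℕ) (x : ℂ) : ℝ :=
  ((n : ℝ) - 1) / Real.pi * ∫ r in Set.Ioi (1 : ℝ), densityIntegrand n x r

end SU2

namespace SU2

open Set Function ComplexConjugate
open scoped Topology ENNReal

/-! The argument is a Kac–Rice computation in which the linear coefficient $a_1$ plays the role of
the conditioned variable. Since $p'(z)=\sqrt n\,a_1+(\text{terms free of }a_1)$, freezing the other
coefficients turns $p'(z)=0$ into $a_1=s(z)$ for a polynomial $s$ (`solveLinear`) with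
$s'=-p''/\sqrt n$. At such a point $p(z)=p(z)-zp'(z)$, which again does not involve $a_1$.
Integrating over $a_1$ by the area formula for $s$ (`lintegral_lintegral_count_fibre`) converts the
sum over critical points into an integral over $z$ with Jacobian $|p''(z)|^2/n$ and weight the
Gaussian density at $s(z)$. Sard's theorem for $s$ shows that degenerate critical points almost
surely do not occur (`ae_nondegenerate`).

After Tonelli, $z$ is fixed. Under the weighted Gaussian law the pair $(p-zp',p'')(z)$ has, up to
mass, the law of $(x,\beta x+\tau b)$ with $x,b$ independent complex Gaussians
(`map_tangent_deriv2_eq`); the parameters come from factorial moments of $\binom nj$. Averaging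
$|\beta x+\tau b|^2$ over $b$ leaves an explicit density in $x$ (`lintegral_fixedPoint`).

That density depends on $z$ only through $r=1+|z|^2$. Polar coordinates reduce the $z$-integral to
one over $r>1$, and integration by parts removes the term carrying $|x|^2$ in front of the
exponential (`integral_radialDensity`). Uniqueness is the fundamental lemma of the calculus of
variations. -/

/-! ### Sums over fibres, the area formula and Sard's theorem -/

/-- Lusin–Souslin: an injective measurable map on a Borel piece of a standard Borel space is a
measurable embedding. The extension by zero is the fibre sum over that piece. -/
theorem measurable_extend_domRestrict {X W : Type*} [MeasurableSpace X] [StandardBorelSpace X]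
    [MeasurableSpace W] [MeasurableSpace.CountablySeparated W]
    {Φ : X → W} (hΦ : Measurable Φ) {A : Set X}
    (hA : MeasurableSet A) (hinj : InjOn Φ A) {h : X → ℝ≥0∞} (hh : Measurable h) :
    Measurable (extend (fun x : A => Φ x) (fun x : A => h x) 0) := by
  have : StandardBorelSpace A := hA.standardBorel
  have hemb : MeasurableEmbedding (fun x : A => Φ x) :=
    (hΦ.comp measurable_subtype_coe).measurableEmbedding (injOn_iff_injective.1 hinj)
  exact hemb.measurable_extend (hh.comp measurable_subtype_coe) measurable_const

theorem lintegral_count_inter_fibre {X W : Type*} [MeasurableSpace X] [MeasurableSingletonClass X]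
    {Φ : X → W} {A : Set X}
    (hinj : InjOn Φ A) (h : X → ℝ≥0∞) (w : W) :
    ∫⁻ x in A ∩ Φ ⁻¹' {w}, h x ∂Measure.count
      = extend (fun x : A => Φ x) (fun x : A => h x) 0 w := by
  by_cases hw : ∃ x : A, Φ x = w
  · obtain ⟨⟨x, hx⟩, rfl⟩ := hw
    have hs : A ∩ Φ ⁻¹' {Φ x} = {x} := by
      ext y
      simp only [mem_inter_iff, mem_preimage, mem_singleton_iff]
      exact ⟨fun hy => hinj hy.1 hx hy.2, fun hy => by subst hy; exact ⟨hx, rfl⟩⟩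
    have := (injOn_iff_injective.1 hinj).extend_apply (fun x : A => h x) 0 ⟨x, hx⟩
    rw [hs, lintegral_singleton, Measure.count_singleton, mul_one]
    exact this.symm
  · have hs : A ∩ Φ ⁻¹' {w} = ∅ := by
      ext y
      simp only [mem_inter_iff, mem_preimage, mem_singleton_iff, mem_empty_iff_false, iff_false]
      exact fun hy => hw ⟨⟨y, hy.1⟩, hy.2⟩
    rw [hs, extend_apply' _ _ _ hw]
    simp

theorem lintegral_count_fibre_eq_tsum {X W : Type*} [MeasurableSpace X]
    [MeasurableSingletonClass X] [MeasurableSpace W] [MeasurableSingletonClass W]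
    {Φ : X → W} (hΦ : Measurable Φ)
    {A : ℕ → Set X} (hA : ∀ i, MeasurableSet (A i)) (hd : Pairwise (Disjoint on A))
    (hinj : ∀ i, InjOn Φ (A i)) (h : X → ℝ≥0∞) (w : W) :
    ∫⁻ x in (⋃ i, A i) ∩ Φ ⁻¹' {w}, h x ∂Measure.count
      = ∑' i, extend (fun x : A i => Φ x) (fun x : A i => h x) 0 w := by
  rw [iUnion_inter, lintegral_iUnion (fun i => (hA i).inter (hΦ (measurableSet_singleton w)))]
  · exact tsum_congr fun i => lintegral_count_inter_fibre (hinj i) h w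
  · exact fun i j hij => (hd hij).mono inter_subset_left inter_subset_left

section CountingFibres

variable {X W : Type*} [TopologicalSpace X] [MeasurableSpace X] [BorelSpace X]
  [SecondCountableTopology X]

/-- A measurable set on which `Φ` is locally injective is a countable disjoint union of measurable
sets on which `Φ` is injective. -/
theorem exists_measurable_partition_injOn {Φ : X → W} {U : Set X} (hU : MeasurableSet U)
    (hloc : ∀ x ∈ U, ∃ O : Set X, IsOpen O ∧ x ∈ O ∧ InjOn Φ (O ∩ U)) :
    ∃ A : ℕ → Set X, (∀ i, MeasurableSet (A i)) ∧ Pairwise (Disjoint on A) ∧ (⋃ i, A i) = U ∧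
      ∀ i, InjOn Φ (A i) := by
  rcases U.eq_empty_or_nonempty with rfl | hne
  · exact ⟨fun _ => ∅, by simp, fun i j _ => by simp [onFun], by simp, by simp⟩
  choose! O hO hxO hinj using hloc
  -- Second countability reduces the cover to countably many injectivity neighbourhoods, which are
  -- then made disjoint.
  obtain ⟨t, htU, htc, hcov⟩ := TopologicalSpace.countable_cover_nhdsWithin (s := U) (f := O)
    fun x hx => mem_nhdsWithin_of_mem_nhds ((hO x hx).mem_nhds (hxO x hx))
  have htne : t.Nonempty := by
    obtain ⟨x, hx⟩ := hne
    obtain ⟨y, hy, -⟩ := mem_iUnion₂.1 (hcov hx)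
    exact ⟨y, hy⟩
  obtain ⟨e, rfl⟩ := htc.exists_eq_range htne
  have heU : ∀ i, e i ∈ U := fun i => htU (mem_range_self i)
  refine ⟨disjointed fun i => O (e i) ∩ U, ?_, disjoint_disjointed _, ?_, ?_⟩
  · exact fun i => MeasurableSet.disjointed (fun i => (hO _ (heU i)).measurableSet.inter hU) i
  · rw [iUnion_disjointed, ← iUnion_inter, inter_eq_right]
    simpa using hcov
  · exact fun i => (hinj _ (heU i)).mono (disjointed_le _ i)

variable [MeasurableSpace W] [StandardBorelSpace X] [MeasurableSpace.CountablySeparated W]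

/-- Sums over the fibres of a locally injective map depend measurably on the base point. -/
theorem measurable_lintegral_count_fibre [MeasurableSingletonClass X] [MeasurableSingletonClass W]
    {Φ : X → W} (hΦ : Measurable Φ) {U : Set X} (hU : MeasurableSet U)
    (hloc : ∀ x ∈ U, ∃ O : Set X, IsOpen O ∧ x ∈ O ∧ InjOn Φ (O ∩ U))
    {h : X → ℝ≥0∞} (hh : Measurable h) :
    Measurable fun w => ∫⁻ x in U ∩ Φ ⁻¹' {w}, h x ∂Measure.count := by
  obtain ⟨A, hA, hd, rfl, hinj⟩ := exists_measurable_partition_injOn hU hloc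
  simp_rw [lintegral_count_fibre_eq_tsum hΦ hA hd hinj h]
  exact Measurable.tsum fun i => measurable_extend_domRestrict hΦ (hA i) (hinj i) hh

end CountingFibres

/-- This is the real Jacobian of a holomorphic map, which enters both the area formula and Sard's
theorem. -/
theorem det_restrictScalars_smulRight (c : ℂ) :
    ((ContinuousLinearMap.toSpanSingleton ℂ c).restrictScalars ℝ : ℂ →L[ℝ] ℂ).det
      = ‖c‖ ^ 2 := by
  have h : ((ContinuousLinearMap.toSpanSingleton ℂ c).restrictScalars ℝ : ℂ →L[ℝ] ℂ).det
      = LinearMap.det (LinearMap.mulLeft ℝ c) := by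
    rw [ContinuousLinearMap.det]
    congr 1
    ext
    simp [mul_comm]
  rw [h, ← LinearMap.det_toMatrix Complex.basisOneI, Matrix.det_fin_two, Complex.sq_norm,
    Complex.normSq_apply]
  simp [LinearMap.toMatrix_apply]

/-- Area formula for a holomorphic function on `ℂ`: summing over the regular points of the fibres
of `f` and integrating over the target gives the integral against `|f'|²`. -/
theorem lintegral_lintegral_count_fibre {f f' : ℂ → ℂ} (hf : ∀ z, HasStrictDerivAt f (f' z) z)
    (hf' : Measurable f') {h : ℂ → ℝ≥0∞} (hh : Measurable h) :
    ∫⁻ w, ∫⁻ z in {z | f' z ≠ 0} ∩ f ⁻¹' {w}, h z ∂Measure.count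
      = ∫⁻ z, ENNReal.ofReal (‖f' z‖ ^ 2) * h z := by
  have hfm : Measurable f :=
    (continuous_iff_continuousAt.2 fun z => (hf z).hasDerivAt.continuousAt).measurable
  have hU : MeasurableSet {z | f' z ≠ 0} := (hf' (measurableSet_singleton 0)).compl
  obtain ⟨A, hA, hd, hAU, hinj⟩ := exists_measurable_partition_injOn (Φ := f) hU (by
    intro z hz
    let e := (hf z).hasStrictFDerivAt_equiv hz |>.toOpenPartialHomeomorph f
    refine ⟨e.source, e.open_source,
      HasStrictFDerivAt.mem_toOpenPartialHomeomorph_source _, ?_⟩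
    exact e.injOn.mono inter_subset_left)
  simp_rw [← hAU, lintegral_count_fibre_eq_tsum hfm hA hd hinj h]
  rw [lintegral_tsum fun i => (measurable_extend_domRestrict hfm (hA i) (hinj i) hh).aemeasurable]
  -- The factor `‖f' z‖ ^ 2` vanishes at the critical points, so they do not contribute to the
  -- right-hand side.
  have hcompl : ∫⁻ z, ENNReal.ofReal (‖f' z‖ ^ 2) * h z
      = ∫⁻ z in ⋃ i, A i, ENNReal.ofReal (‖f' z‖ ^ 2) * h z := by
    rw [hAU, ← lintegral_indicator hU]
    refine lintegral_congr fun z => ?_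
    by_cases hz : f' z = 0 <;> simp [hz]
  rw [hcompl, lintegral_iUnion hA hd]
  refine tsum_congr fun i => ?_
  have hder : ∀ z ∈ A i, HasFDerivWithinAt f
      ((ContinuousLinearMap.toSpanSingleton ℂ (f' z)).restrictScalars ℝ) (A i) z :=
    fun z _ => ((hf z).hasDerivAt.hasFDerivAt.restrictScalars ℝ).hasFDerivWithinAt
  have himg : MeasurableSet (f '' A i) := (hA i).image_of_measurable_injOn hfm (hinj i)
  set G := extend (fun x : A i => f x) (fun x : A i => h x) 0 with hG
  have hG0 : ∀ w, w ∉ f '' A i → G w = 0 := fun w hw => by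
    rw [hG, extend_apply' _ _ _ (by rintro ⟨x, hx⟩; exact hw ⟨x, x.2, hx⟩), Pi.zero_apply]
  calc ∫⁻ w, G w = ∫⁻ w in f '' A i, G w := by
        rw [← lintegral_indicator himg]
        refine lintegral_congr fun w => ?_
        by_cases hw : w ∈ f '' A i
        · rw [indicator_of_mem hw]
        · rw [indicator_of_notMem hw, hG0 w hw]
    _ = ∫⁻ z in A i, ENNReal.ofReal (‖f' z‖ ^ 2) * h z := by
        rw [lintegral_image_eq_lintegral_abs_det_fderiv_mul volume (hA i) hder (hinj i)]
        refine setLIntegral_congr_fun (hA i) fun z hz => ?_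
        simp only [det_restrictScalars_smulRight, abs_pow, abs_norm]
        have := (injOn_iff_injective.1 (hinj i)).extend_apply (fun x : A i => h x) 0 ⟨z, hz⟩
        exact congrArg _ this

/-- Sard's theorem for holomorphic functions on `ℂ`. -/
theorem volume_image_deriv_eq_zero {f f' : ℂ → ℂ} (hf : ∀ z, HasDerivAt f (f' z) z) :
    volume (f '' {z | f' z = 0}) = 0 := by
  refine addHaar_image_eq_zero_of_det_fderivWithin_eq_zero volume
    (f' := fun z => (ContinuousLinearMap.toSpanSingleton ℂ (f' z)).restrictScalars ℝ)
    (fun z _ => ((hf z).hasFDerivAt.restrictScalars ℝ).hasFDerivWithinAt) fun z hz => ?_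
  rw [det_restrictScalars_smulRight, show f' z = 0 from hz]
  simp

/-! ### Complex Gaussian laws and their Fourier transforms -/

/-- The centred complex Gaussian law with density `(A/π) exp (-A|z|²)`. -/
noncomputable def complexGaussian (A : ℝ) : Measure ℂ :=
  (volume : Measure ℂ).withDensity fun z => ENNReal.ofReal (A / Real.pi * Real.exp (-(A * ‖z‖ ^ 2)))

theorem stdComplexGaussian_eq : stdComplexGaussian = complexGaussian 1 := by
  simp [stdComplexGaussian, complexGaussian]

theorem integral_complexGaussian {A : ℝ} (hA : 0 < A) (f : ℂ → ℂ) :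
    ∫ z, f z ∂complexGaussian A
      = ∫ z, ((A / Real.pi : ℝ) : ℂ) * (Complex.exp (-(A : ℂ) * ‖z‖ ^ 2) * f z) := by
  rw [complexGaussian, integral_withDensity_eq_integral_toReal_smul (by fun_prop) (by simp)]
  refine integral_congr_ae (.of_forall fun z => ?_)
  have : 0 ≤ A / Real.pi * Real.exp (-(A * ‖z‖ ^ 2)) := by positivity
  simp only [ENNReal.toReal_ofReal this, Complex.real_smul]
  push_cast
  ring_nf

theorem integral_exp_sq_norm_add_inner {b : ℝ} (hb : 0 < b) (c w : ℂ) :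
    ∫ v : ℂ, Complex.exp (-(b : ℂ) * ‖v‖ ^ 2 + c * (inner ℝ w v : ℝ))
      = (Real.pi / b : ℝ) * Complex.exp (c ^ 2 * ‖w‖ ^ 2 / (4 * b)) := by
  rw [GaussianFourier.integral_cexp_neg_mul_sq_norm_add (by simpa using hb)]
  simp [Complex.finrank_real_complex]

theorem integral_exp_inner_complexGaussian {A : ℝ} (hA : 0 < A) (c w : ℂ) :
    ∫ v, Complex.exp (c * (inner ℝ w v : ℝ)) ∂complexGaussian A
      = Complex.exp (c ^ 2 * ‖w‖ ^ 2 / (4 * A)) := by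
  rw [integral_complexGaussian hA, integral_const_mul]
  simp_rw [← Complex.exp_add]
  rw [integral_exp_sq_norm_add_inner hA, ← mul_assoc, ← Complex.ofReal_mul]
  have : A / Real.pi * (Real.pi / A) = 1 := by field_simp
  rw [this]; simp

theorem isProbabilityMeasure_complexGaussian {A : ℝ} (hA : 0 < A) :
    IsProbabilityMeasure (complexGaussian A) := by
  have hfin : IsFiniteMeasure (complexGaussian A) := by
    refine isFiniteMeasure_withDensity_ofReal (Integrable.hasFiniteIntegral ?_)
    have := (GaussianFourier.integrable_cexp_neg_mul_sq_norm_add (V := ℂ) (b := (A : ℂ))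
      (by simpa using hA) 0 0).norm.const_mul (A / Real.pi)
    refine this.congr (.of_forall fun z => ?_)
    simp [Complex.norm_exp, ← Complex.ofReal_pow]
  -- The Fourier–Laplace formula at the origin is the total mass.
  have h := integral_exp_inner_complexGaussian hA 0 0
  simp only [zero_mul, Complex.exp_zero, integral_const, ne_eq, OfNat.ofNat_ne_zero,
    not_false_eq_true, zero_pow, zero_div, Complex.real_smul, mul_one, Complex.ofReal_eq_one] at h
  constructor
  rw [measureReal_def] at h
  rw [← ENNReal.ofReal_toReal (measure_ne_top _ _), h, ENNReal.ofReal_one]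

instance : IsProbabilityMeasure stdComplexGaussian :=
  stdComplexGaussian_eq ▸ isProbabilityMeasure_complexGaussian one_pos

theorem integral_exp_re_mul_complexGaussian {A : ℝ} (hA : 0 < A) (t : ℂ) :
    ∫ v, Complex.exp ((t * v).re * Complex.I) ∂complexGaussian A
      = Complex.exp (-(‖t‖ ^ 2 / (4 * A) : ℝ)) := by
  have := integral_exp_inner_complexGaussian hA Complex.I (conj t)
  simp only [Complex.inner, Complex.conj_conj, Complex.I_sq, RCLike.norm_conj] at this
  convert this using 3
  · rw [mul_comm, mul_comm t]
  · push_cast; ring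

/-! ### Gaussian vectors with a Gaussian weight -/

section Pi

variable {ι : Type*} [Fintype ι]

theorem integral_exp_re_linear_pi (d : ι → ℂ) :
    ∫ a, Complex.exp ((∑ j, d j * a j).re * Complex.I) ∂Measure.pi (fun _ : ι => stdComplexGaussian)
      = Complex.exp (-((∑ j, ‖d j‖ ^ 2) / 4 : ℝ)) := by
  simp_rw [Complex.re_sum, Complex.ofReal_sum, Finset.sum_mul, Complex.exp_sum]
  rw [integral_fintype_prod_eq_prod (f := fun j x => Complex.exp ((d j * x).re * Complex.I))]
  simp_rw [stdComplexGaussian_eq, integral_exp_re_mul_complexGaussian one_pos]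
  rw [← Complex.exp_sum, Finset.sum_neg_distrib, Finset.sum_div, Complex.ofReal_sum]
  simp

theorem sum_normSq_add (c d : ι → ℂ) (t u : ℂ) :
    ((∑ j, ‖t * c j + u * d j‖ ^ 2 : ℝ) : ℂ)
      = t * conj t * ∑ j, conj (c j) * c j + conj t * u * ∑ j, conj (c j) * d j
        + t * conj u * conj (∑ j, conj (c j) * d j) + u * conj u * ∑ j, conj (d j) * d j := by
  simp only [Complex.ofReal_sum, Complex.ofReal_pow, ← Complex.mul_conj', map_add, map_mul,
    map_sum, Complex.conj_conj, Finset.mul_sum, ← Finset.sum_add_distrib]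
  exact Finset.sum_congr rfl fun j _ => by ring

/-- The Fourier transform of the law of a linear functional of a Gaussian vector weighted by the
Gaussian of another linear functional. -/
theorem integral_exp_sq_mul_exp_re_linear_pi {κ : ℝ} (hκ : 0 ≤ κ) (c d : ι → ℂ) :
    ∫ a, (Real.exp (-(κ * ‖∑ j, c j * a j‖ ^ 2)) : ℂ) *
        Complex.exp ((∑ j, d j * a j).re * Complex.I)
        ∂Measure.pi (fun _ : ι => stdComplexGaussian)
      = ((1 + κ * ∑ j, ‖c j‖ ^ 2 : ℝ) : ℂ)⁻¹ *
        Complex.exp (-(((∑ j, ‖d j‖ ^ 2) - κ * ‖∑ j, conj (c j) * d j‖ ^ 2 /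
          (1 + κ * ∑ j, ‖c j‖ ^ 2)) / 4 : ℝ)) := by
  set μ := Measure.pi (fun _ : ι => stdComplexGaussian)
  set q := Real.sqrt κ
  have hq : q ^ 2 = κ := Real.sq_sqrt hκ
  set S := ∑ j, ‖c j‖ ^ 2
  have hS : 0 ≤ S := Finset.sum_nonneg fun j _ => by positivity
  have hpos : 0 < 1 + κ * S := by positivity
  set T := ∑ j, conj (c j) * d j with hT
  -- Linearise the quadratic weight: it is the average of characters over an auxiliary standard
  -- Gaussian `v`. The factor `2 * q` compensates the `1 / 4` in the characteristic function. Fubini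
  -- then leaves a Gaussian integral in `a` followed by one in `v`.
  have key : ∀ a : ι → ℂ, (Real.exp (-(κ * ‖∑ j, c j * a j‖ ^ 2)) : ℂ) *
        Complex.exp ((∑ j, d j * a j).re * Complex.I)
      = ∫ v, Complex.exp ((∑ j, (2 * q * v * c j + 1 * d j) * a j).re * Complex.I)
          ∂stdComplexGaussian := by
    intro a
    have h := integral_exp_re_mul_complexGaussian one_pos (2 * q * ∑ j, c j * a j)
    rw [← stdComplexGaussian_eq] at h
    have e : -(κ * ‖∑ j, c j * a j‖ ^ 2) = -(‖2 * q * ∑ j, c j * a j‖ ^ 2 / (4 * 1)) := by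
      rw [norm_mul, norm_mul, Complex.norm_real, mul_pow, mul_pow, Real.norm_eq_abs, sq_abs, hq]
      norm_num; ring
    rw [e, Complex.ofReal_exp, Complex.ofReal_neg, ← h, ← integral_mul_const]
    refine integral_congr_ae (.of_forall fun v => ?_)
    simp only [← Complex.exp_add, ← add_mul, ← Complex.ofReal_add, ← Complex.add_re]
    congr 4
    rw [Finset.mul_sum, Finset.sum_mul, ← Finset.sum_add_distrib]
    exact Finset.sum_congr rfl fun j _ => by ring
  simp_rw [key]
  rw [integral_integral_swap]
  · rw [integral_congr_ae (.of_forall fun v =>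
      integral_exp_re_linear_pi fun j => 2 * q * v * c j + 1 * d j)]
    rw [stdComplexGaussian_eq, integral_complexGaussian one_pos, integral_const_mul]
    -- Collecting the terms in `v` gives a Gaussian of inverse variance `1 + κ * S`, with a linear
    -- term along `T`; its integral produces both the prefactor and the correction to the
    -- covariance.
    have e : ∀ v : ℂ, Complex.exp (-((1 : ℝ) : ℂ) * ‖v‖ ^ 2) *
          Complex.exp (-((∑ j, ‖2 * q * v * c j + 1 * d j‖ ^ 2) / 4 : ℝ))
        = Complex.exp (-((1 + κ * S : ℝ) : ℂ) * ‖v‖ ^ 2 + (-q : ℂ) * (inner ℝ T v : ℝ)) *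
          Complex.exp (-((∑ j, ‖d j‖ ^ 2) / 4 : ℝ)) := by
      intro v
      rw [← Complex.exp_add, ← Complex.exp_add, Complex.ofReal_div, sum_normSq_add, ← hT]
      congr 1
      have h1 : (∑ j, conj (c j) * c j : ℂ) = S := by
        simp [S, Complex.conj_mul']
      have h2 : (∑ j, conj (d j) * d j : ℂ) = (∑ j, ‖d j‖ ^ 2 : ℝ) := by
        simp [Complex.conj_mul']
      have h3 : ((inner ℝ T v : ℝ) : ℂ) = (v * conj T + conj v * T) / 2 := by
        rw [Complex.inner, Complex.re_eq_add_conj]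
        simp
      rw [h1, h2, h3, ← Complex.conj_mul' v, ← hq]
      simp only [map_mul, Complex.conj_ofReal, map_ofNat, map_one]
      push_cast
      ring
    simp_rw [e]
    rw [integral_mul_const, integral_exp_sq_norm_add_inner hpos, mul_assoc, ← Complex.exp_add,
      ← mul_assoc, ← Complex.ofReal_mul]
    congr 1
    · rw [← Complex.ofReal_inv]
      congr 1
      field_simp
    · congr 1
      rw [neg_sq, ← Complex.ofReal_pow, hq]
      push_cast
      have : ((1 : ℂ) + κ * S) ≠ 0 := by exact_mod_cast hpos.ne'
      field_simp
      ring
  · refine Integrable.of_bound (C := 1) (Continuous.aestronglyMeasurable ?_) ?_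
    · simp only [uncurry_def]
      fun_prop
    · exact .of_forall fun x => (Complex.norm_exp_ofReal_mul_I _).le

theorem exists_re_mul_eq_strongDual (L : StrongDual ℝ (ℂ × ℂ)) :
    ∃ t u : ℂ, ∀ x y : ℂ, L (x, y) = (t * x + u * y).re := by
  refine ⟨⟨L (1, 0), -L (Complex.I, 0)⟩, ⟨L (0, 1), -L (0, Complex.I)⟩, fun x y => ?_⟩
  have : ((x, y) : ℂ × ℂ) = x.re • (1, 0) + x.im • (Complex.I, 0) + y.re • (0, 1)
      + y.im • (0, Complex.I) := by
    ext <;> simp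
  rw [this]
  simp only [map_add, map_smul, smul_eq_mul, Complex.add_re, Complex.mul_re]
  ring

/-- Two linear functionals of a Gaussian vector, weighted by the Gaussian of a third one, have up to
a constant the joint law of `(x, βx + τb)`, where `x` and `b` are independent Gaussians. -/
theorem map_withDensity_pi_eq {κ A τ : ℝ} (hκ : 0 ≤ κ) (hA : 0 < A) (β : ℂ) (c d₀ d₂ : ι → ℂ)
    (h₀₀ : ∑ j, conj (d₀ j) * d₀ j - κ * (conj (∑ j, conj (c j) * d₀ j) * ∑ j, conj (c j) * d₀ j) /
      (1 + κ * ∑ j, conj (c j) * c j) = 1 / A)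
    (h₀₂ : ∑ j, conj (d₀ j) * d₂ j - κ * (conj (∑ j, conj (c j) * d₀ j) * ∑ j, conj (c j) * d₂ j) /
      (1 + κ * ∑ j, conj (c j) * c j) = β / A)
    (h₂₂ : ∑ j, conj (d₂ j) * d₂ j - κ * (conj (∑ j, conj (c j) * d₂ j) * ∑ j, conj (c j) * d₂ j) /
      (1 + κ * ∑ j, conj (c j) * c j) = conj β * β / A + τ ^ 2) :
    ((Measure.pi (fun _ : ι => stdComplexGaussian)).withDensity
        fun a => ENNReal.ofReal (Real.exp (-(κ * ‖∑ j, c j * a j‖ ^ 2)))).map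
        (fun a => (∑ j, d₀ j * a j, ∑ j, d₂ j * a j))
      = ENNReal.ofReal (1 + κ * ∑ j, ‖c j‖ ^ 2)⁻¹ •
        ((complexGaussian A).prod stdComplexGaussian).map
          (fun x => (x.1, β * x.1 + τ * x.2)) := by
  have := isProbabilityMeasure_complexGaussian hA
  set μ := Measure.pi (fun _ : ι => stdComplexGaussian)
  have hfin : IsFiniteMeasure (μ.withDensity
      fun a => ENNReal.ofReal (Real.exp (-(κ * ‖∑ j, c j * a j‖ ^ 2)))) := by
    refine isFiniteMeasure_withDensity_ofReal (Integrable.hasFiniteIntegral ?_)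
    refine Integrable.of_bound (C := 1) (Continuous.aestronglyMeasurable (by fun_prop)) ?_
    refine .of_forall fun a => ?_
    rw [Real.norm_eq_abs, Real.abs_exp, Real.exp_le_one_iff, neg_nonpos]
    positivity
  set S := ∑ j, ‖c j‖ ^ 2
  have hS : 0 ≤ S := Finset.sum_nonneg fun j _ => by positivity
  have hpos : 0 < 1 + κ * S := by positivity
  have hcc : (∑ j, conj (c j) * c j : ℂ) = S := by simp [S, Complex.conj_mul']
  have hfin2 : IsFiniteMeasure (ENNReal.ofReal (1 + κ * S)⁻¹ •
        ((complexGaussian A).prod stdComplexGaussian).map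
          (fun x => (x.1, β * x.1 + τ * x.2))) := Measure.smul_finite _ ENNReal.ofReal_ne_top
  -- Equality of characteristic functions: the three hypotheses equate the entries of the weighted
  -- covariance matrix (a rank-one Schur complement) with those of `(x, βx + τb)`.
  refine Measure.ext_of_charFunDual (funext fun L => ?_)
  obtain ⟨t, u, hL⟩ := exists_re_mul_eq_strongDual L
  rw [charFunDual_apply, charFunDual_apply, integral_smul_measure,
    integral_map (by fun_prop) (Continuous.aestronglyMeasurable (by fun_prop)),
    integral_map (by fun_prop) (Continuous.aestronglyMeasurable (by fun_prop)),
    integral_withDensity_eq_integral_toReal_smul (by fun_prop) (by simp),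
    ENNReal.toReal_ofReal (by positivity)]
  simp_rw [hL, ENNReal.toReal_ofReal (Real.exp_pos _).le, Complex.real_smul]
  have e1 : ∀ a : ι → ℂ, t * ∑ j, d₀ j * a j + u * ∑ j, d₂ j * a j
      = ∑ j, (t * d₀ j + u * d₂ j) * a j := fun a => by
    rw [Finset.mul_sum, Finset.mul_sum, ← Finset.sum_add_distrib]
    exact Finset.sum_congr rfl fun j _ => by ring
  have e2 : ∀ x : ℂ × ℂ, Complex.exp ((t * x.1 + u * (β * x.1 + τ * x.2)).re * Complex.I)
      = Complex.exp (((t + u * β) * x.1).re * Complex.I) *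
        Complex.exp (((u * τ) * x.2).re * Complex.I) := fun x => by
    rw [← Complex.exp_add, ← add_mul, ← Complex.ofReal_add, ← Complex.add_re]
    congr 4; ring
  simp_rw [e1, e2]
  rw [integral_exp_sq_mul_exp_re_linear_pi hκ c,
    integral_prod_mul (fun x => Complex.exp (((t + u * β) * x).re * Complex.I))
      (fun x => Complex.exp (((u * τ) * x).re * Complex.I)),
    integral_exp_re_mul_complexGaussian hA, stdComplexGaussian_eq,
    integral_exp_re_mul_complexGaussian one_pos, ← Complex.exp_add]
  rw [show (1 + κ * ∑ j, ‖c j‖ ^ 2) = 1 + κ * S from rfl]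
  congr 1
  · push_cast; rfl
  push_cast
  congr 1
  have h1 := sum_normSq_add d₀ d₂ t u
  have h2 : (∑ j, conj (c j) * (t * d₀ j + u * d₂ j))
      = t * (∑ j, conj (c j) * d₀ j) + u * ∑ j, conj (c j) * d₂ j := by
    rw [Finset.mul_sum, Finset.mul_sum, ← Finset.sum_add_distrib]
    exact Finset.sum_congr rfl fun j _ => by ring
  push_cast at h1
  rw [hcc] at h₀₀ h₀₂ h₂₂
  -- The remaining off-diagonal entry, by Hermitian symmetry.
  have h₂₀ := congrArg conj h₀₂
  rw [h1, h2]
  simp only [← Complex.conj_mul', map_add, map_mul, map_sub, map_div₀, Complex.conj_ofReal,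
    Complex.conj_conj, map_one] at h₂₀ ⊢
  set T₀ := ∑ j, conj (c j) * d₀ j
  set T₂ := ∑ j, conj (c j) * d₂ j
  linear_combination (-1/4) * (t * conj t * h₀₀ + conj t * u * h₀₂ + t * conj u * h₂₀
    + u * conj u * h₂₂)

end Pi

/-! ### Second moments -/

theorem lintegral_sq_norm_stdComplexGaussian :
    ∫⁻ z, ENNReal.ofReal (‖z‖ ^ 2) ∂stdComplexGaussian = 1 := by
  have h := Complex.integral_rpow_mul_exp_neg_rpow (p := 2) (q := 2) (by norm_num) (by norm_num)
  simp only [Real.rpow_ofNat] at h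
  have h' : ∫ z : ℂ, ‖z‖ ^ 2 * Real.exp (-‖z‖ ^ 2) = Real.pi := by
    rw [h]; norm_num
  have hint : Integrable fun z : ℂ => ‖z‖ ^ 2 * Real.exp (-‖z‖ ^ 2) :=
    Integrable.of_integral_ne_zero (h' ▸ Real.pi_ne_zero)
  rw [stdComplexGaussian, lintegral_withDensity_eq_lintegral_mul _ (by fun_prop) (by fun_prop)]
  have e : ∀ z : ℂ, ((fun z : ℂ => ENNReal.ofReal (Real.pi⁻¹ * Real.exp (-‖z‖ ^ 2))) *
      fun z : ℂ => ENNReal.ofReal (‖z‖ ^ 2) : ℂ → ℝ≥0∞) z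
      = ENNReal.ofReal (Real.pi⁻¹ * (‖z‖ ^ 2 * Real.exp (-‖z‖ ^ 2))) := fun z => by
    rw [Pi.mul_apply, ← ENNReal.ofReal_mul (by positivity)]
    ring_nf
  simp_rw [e]
  rw [← ofReal_integral_eq_lintegral_ofReal (hint.const_mul _)
    (.of_forall fun z => by positivity), integral_const_mul, h']
  simp [Real.pi_ne_zero]

theorem lintegral_neg_stdComplexGaussian {f : ℂ → ℝ≥0∞} (hf : Measurable f) :
    ∫⁻ z, f (-z) ∂stdComplexGaussian = ∫⁻ z, f z ∂stdComplexGaussian := by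
  rw [stdComplexGaussian, lintegral_withDensity_eq_lintegral_mul _ (by fun_prop) (by fun_prop),
    lintegral_withDensity_eq_lintegral_mul _ (by fun_prop) hf]
  rw [← lintegral_neg_eq_self]
  simp

/-- Averaging over `z` and `-z`, the parallelogram law removes the cross term, so only nonnegative
integrals occur. -/
theorem lintegral_sq_norm_add_stdComplexGaussian (α : ℂ) (τ : ℝ) :
    ∫⁻ z, ENNReal.ofReal (‖α + τ * z‖ ^ 2) ∂stdComplexGaussian
      = ENNReal.ofReal (‖α‖ ^ 2 + τ ^ 2) := by
  have hneg := lintegral_neg_stdComplexGaussian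
    (f := fun z => ENNReal.ofReal (‖α + τ * z‖ ^ 2)) (by fun_prop)
  have hsum : ∫⁻ z, ENNReal.ofReal (‖α + τ * z‖ ^ 2) ∂stdComplexGaussian
      + ∫⁻ z, ENNReal.ofReal (‖α + τ * -z‖ ^ 2) ∂stdComplexGaussian
      = 2 * ENNReal.ofReal (‖α‖ ^ 2 + τ ^ 2) := by
    rw [← lintegral_add_left (by fun_prop)]
    have e : ∀ z : ℂ, ENNReal.ofReal (‖α + τ * z‖ ^ 2) + ENNReal.ofReal (‖α + τ * -z‖ ^ 2)
        = ENNReal.ofReal (2 * ‖α‖ ^ 2) + ENNReal.ofReal (2 * τ ^ 2) * ENNReal.ofReal (‖z‖ ^ 2) := by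
      intro z
      rw [← ENNReal.ofReal_mul (by positivity), ← ENNReal.ofReal_add (by positivity)
        (by positivity), ← ENNReal.ofReal_add (by positivity) (by positivity)]
      congr 1
      have := parallelogram_law_with_norm ℝ α (τ * z)
      rw [norm_mul, Complex.norm_real, Real.norm_eq_abs] at this
      rw [mul_neg, ← sub_eq_add_neg]
      nlinarith [sq_abs τ]
    simp_rw [e]
    rw [lintegral_add_left (by fun_prop), lintegral_const_mul _ (by fun_prop),
      lintegral_sq_norm_stdComplexGaussian, lintegral_const, measure_univ, mul_one, mul_one,
      ← ENNReal.ofReal_add (by positivity) (by positivity), ← mul_add,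
      ENNReal.ofReal_mul (by norm_num), ENNReal.ofReal_ofNat]
  rw [hneg, ← two_mul] at hsum
  exact (ENNReal.mul_right_inj (by norm_num) (by norm_num)).1 hsum

/-! ### The functionals $p$, $p'$, $p''$, $p-zp'$ and their Gram matrix -/

/-- The coefficient vector of `a ↦ p(z)`. -/
noncomputable def evalCoeff (n : ℕ) (z : ℂ) (j : Fin (n + 1)) : ℂ :=
  (Real.sqrt (n.choose j : ℝ) : ℂ) * z ^ (j : ℕ)

/-- The coefficient vector of `a ↦ p'(z)`. -/
noncomputable def derivCoeff (n : ℕ) (z : ℂ) (j : Fin (n + 1)) : ℂ :=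
  (Real.sqrt (n.choose j : ℝ) : ℂ) * ((j : ℕ) * z ^ ((j : ℕ) - 1))

/-- The coefficient vector of `a ↦ p''(z)`. -/
noncomputable def deriv2Coeff (n : ℕ) (z : ℂ) (j : Fin (n + 1)) : ℂ :=
  (Real.sqrt (n.choose j : ℝ) : ℂ) * ((j : ℕ) * (((j : ℕ) - 1 : ℕ) * z ^ ((j : ℕ) - 1 - 1)))

/-- The coefficient vector of `a ↦ p(z) - z p'(z)`. -/
noncomputable def tangentCoeff (n : ℕ) (z : ℂ) (j : Fin (n + 1)) : ℂ :=
  evalCoeff n z j - z * derivCoeff n z j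

theorem eval_poly (n : ℕ) (a : Fin (n + 1) → ℂ) (z : ℂ) :
    (poly n a).eval z = ∑ j, evalCoeff n z j * a j := by
  simp only [poly, eval_finsetSum, eval_mul, eval_C, eval_pow, eval_X, evalCoeff]
  exact Finset.sum_congr rfl fun j _ => by ring

theorem eval_derivative_poly (n : ℕ) (a : Fin (n + 1) → ℂ) (z : ℂ) :
    (poly n a).derivative.eval z = ∑ j, derivCoeff n z j * a j := by
  simp only [poly, derivative_sum, derivative_C_mul, derivative_X_pow, eval_finsetSum, eval_mul,
    eval_C, eval_pow, eval_X, derivCoeff]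
  exact Finset.sum_congr rfl fun j _ => by ring

theorem eval_derivative2_poly (n : ℕ) (a : Fin (n + 1) → ℂ) (z : ℂ) :
    (poly n a).derivative.derivative.eval z = ∑ j, deriv2Coeff n z j * a j := by
  simp only [poly, derivative_sum, derivative_C_mul, derivative_X_pow, eval_finsetSum, eval_mul,
    eval_C, eval_pow, eval_X, deriv2Coeff]
  exact Finset.sum_congr rfl fun j _ => by ring

section Gram

/-- Differentiate the binomial expansion of $(X+1)^n$ $k$ times and evaluate at $s$. -/
theorem sum_choose_descFactorial (n k : ℕ) (s : ℂ) :
    ∑ j : Fin (n + 1), (n.choose j : ℂ) * ((j : ℕ).descFactorial k : ℂ) * s ^ ((j : ℕ) - k)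
      = n.descFactorial k * (1 + s) ^ (n - k) := by
  have h := congrArg (Polynomial.eval s) (iterate_derivative_X_add_pow (R := ℂ) n k 1)
  have h2 : ((X + C (1 : ℂ)) ^ n) = ∑ j ∈ Finset.range (n + 1), C (n.choose j : ℂ) * X ^ j := by
    rw [add_pow]
    refine Finset.sum_congr rfl fun j _ => ?_
    simp [mul_comm]
  rw [h2, iterate_derivative_sum, eval_finsetSum] at h
  simp only [iterate_derivative_C_mul, iterate_derivative_X_pow_eq_smul] at h
  rw [← Fin.sum_univ_eq_sum_range (fun j => Polynomial.eval s (C (n.choose j : ℂ) *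
    ((j.descFactorial k : ℂ) • X ^ (j - k))))] at h
  simp only [eval_mul, eval_C, eval_smul, smul_eq_mul, eval_pow, eval_X, eval_add, nsmul_eq_mul,
    eval_natCast] at h
  rw [add_comm 1 s, ← h]
  exact Finset.sum_congr rfl fun j _ => by ring

theorem cast_descFactorial_succ (n k : ℕ) :
    (n.descFactorial (k + 1) : ℂ) = (n - k) * n.descFactorial k := by
  rcases le_or_gt k n with h | h
  · rw [Nat.descFactorial_succ, Nat.cast_mul, Nat.cast_sub h]
  · simp [Nat.descFactorial_of_lt h]

/-- The truncated exponent `n - k` is harmless: for `k > n` the falling factorial is zero. -/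
theorem descFactorial_mul_pow_sub (n k : ℕ) {r : ℂ} (hr : r ≠ 0) :
    (n.descFactorial k : ℂ) * r ^ (n - k) = n.descFactorial k * (r ^ n / r ^ k) := by
  rcases le_or_gt k n with h | h
  · rw [pow_sub₀ _ hr h, div_eq_mul_inv]
  · simp [Nat.descFactorial_of_lt h]

theorem sqrt_choose_mul_self (n j : ℕ) :
    (Real.sqrt (n.choose j : ℝ) : ℂ) * (Real.sqrt (n.choose j : ℝ) : ℂ) = n.choose j := by
  rw [← Complex.ofReal_mul, Real.mul_self_sqrt (by positivity)]; simp

/-- The terms of the factorial moments of the binomial coefficients. -/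
noncomputable def momentTerm (n k : ℕ) (s : ℂ) (j : ℕ) : ℂ :=
  (n.choose j : ℂ) * (j.descFactorial k : ℂ) * s ^ (j - k)

theorem tangentCoeff_eq (n : ℕ) (z : ℂ) (j : Fin (n + 1)) :
    tangentCoeff n z j = (Real.sqrt (n.choose j : ℝ) : ℂ) * ((1 - (j : ℕ)) * z ^ (j : ℕ)) := by
  rw [tangentCoeff, evalCoeff, derivCoeff]
  rcases (j : ℕ) with _ | j
  · simp
  · simp only [Nat.add_sub_cancel]; ring

variable (n : ℕ) (z : ℂ) (j : Fin (n + 1))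

/-- Expanding in falling factorials, here $(1-j)^2=1-j+j(j-1)$, makes each Gram entry a combination
of closed-form binomial moments. The five lemmas that follow use the same device; the small values
of `j` are split off because of truncated exponents. -/
theorem conj_tangentCoeff_mul_tangentCoeff :
    conj (tangentCoeff n z j) * tangentCoeff n z j
      = momentTerm n 0 (conj z * z) j - conj z * z * momentTerm n 1 (conj z * z) j
        + (conj z * z) ^ 2 * momentTerm n 2 (conj z * z) j := by
  simp only [tangentCoeff_eq, momentTerm, ← sqrt_choose_mul_self, map_mul, Complex.conj_ofReal,
    map_sub, map_one, map_natCast, map_pow]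
  rcases (j : ℕ) with _ | _ | j <;> simp [Nat.descFactorial] <;> ring

theorem conj_tangentCoeff_mul_deriv2Coeff :
    conj (tangentCoeff n z j) * deriv2Coeff n z j
      = -conj z ^ 2 * (conj z * z * momentTerm n 3 (conj z * z) j
        + momentTerm n 2 (conj z * z) j) := by
  simp only [tangentCoeff_eq, deriv2Coeff, momentTerm, ← sqrt_choose_mul_self, map_mul,
    Complex.conj_ofReal, map_sub, map_one, map_natCast, map_pow]
  rcases (j : ℕ) with _ | _ | _ | j <;> simp [Nat.descFactorial] <;> ring

theorem conj_derivCoeff_mul_tangentCoeff :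
    conj (derivCoeff n z j) * tangentCoeff n z j
      = -z * (conj z * z * momentTerm n 2 (conj z * z) j) := by
  simp only [tangentCoeff_eq, derivCoeff, momentTerm, ← sqrt_choose_mul_self, map_mul,
    Complex.conj_ofReal, map_natCast, map_pow]
  rcases (j : ℕ) with _ | _ | j <;> simp [Nat.descFactorial]
  ring

theorem conj_derivCoeff_mul_deriv2Coeff :
    conj (derivCoeff n z j) * deriv2Coeff n z j
      = conj z * (conj z * z * momentTerm n 3 (conj z * z) j
        + 2 * momentTerm n 2 (conj z * z) j) := by
  simp only [deriv2Coeff, derivCoeff, momentTerm, ← sqrt_choose_mul_self, map_mul,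
    Complex.conj_ofReal, map_natCast, map_pow]
  rcases (j : ℕ) with _ | _ | _ | j <;> simp [Nat.descFactorial] <;> ring

theorem conj_derivCoeff_mul_derivCoeff :
    conj (derivCoeff n z j) * derivCoeff n z j
      = conj z * z * momentTerm n 2 (conj z * z) j + momentTerm n 1 (conj z * z) j := by
  simp only [derivCoeff, momentTerm, ← sqrt_choose_mul_self, map_mul,
    Complex.conj_ofReal, map_natCast, map_pow]
  rcases (j : ℕ) with _ | _ | j <;> simp [Nat.descFactorial]
  ring

theorem conj_deriv2Coeff_mul_deriv2Coeff :
    conj (deriv2Coeff n z j) * deriv2Coeff n z j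
      = (conj z * z) ^ 2 * momentTerm n 4 (conj z * z) j
        + 4 * (conj z * z * momentTerm n 3 (conj z * z) j)
        + 2 * momentTerm n 2 (conj z * z) j := by
  simp only [deriv2Coeff, momentTerm, ← sqrt_choose_mul_self, map_mul,
    Complex.conj_ofReal, map_natCast, map_pow]
  rcases (j : ℕ) with _ | _ | _ | _ | j <;> simp [Nat.descFactorial] <;> ring

end Gram

theorem one_add_normSq_ne_zero (z : ℂ) : 1 + conj z * z ≠ 0 := by
  rw [Complex.conj_mul']
  exact_mod_cast (by positivity : (0 : ℝ) < 1 + ‖z‖ ^ 2).ne'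

theorem one_add_nat_mul_normSq_ne_zero (n : ℕ) (z : ℂ) : 1 + n * (conj z * z) ≠ 0 := by
  rw [Complex.conj_mul']
  exact_mod_cast (by positivity : (0 : ℝ) < 1 + n * ‖z‖ ^ 2).ne'

theorem sum_momentTerm (n k : ℕ) (z : ℂ) :
    ∑ j : Fin (n + 1), momentTerm n k (conj z * z) j
      = n.descFactorial k * ((1 + conj z * z) ^ n / (1 + conj z * z) ^ k) := by
  rw [← descFactorial_mul_pow_sub n k (one_add_normSq_ne_zero z), ← sum_choose_descFactorial]
  rfl

/-! ### Separating the linear coefficient; conditional covariances -/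

section LinearCoeff

/-- The index of the linear coefficient. -/
def linearIndex (n : ℕ) (hn : 1 ≤ n) : Fin (n + 1) := ⟨1, Nat.lt_succ_of_le hn⟩

variable {n : ℕ} (hn : 1 ≤ n)

theorem tangentCoeff_linearIndex (z : ℂ) : tangentCoeff n z (linearIndex n hn) = 0 := by
  simp [tangentCoeff_eq, linearIndex]

theorem deriv2Coeff_linearIndex (z : ℂ) : deriv2Coeff n z (linearIndex n hn) = 0 := by
  simp [deriv2Coeff, linearIndex]

theorem derivCoeff_linearIndex (z : ℂ) :
    derivCoeff n z (linearIndex n hn) = (Real.sqrt n : ℂ) := by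
  simp [derivCoeff, linearIndex]

/-- The coefficient vector of `p'(z)` without the contribution of the linear coefficient. -/
noncomputable def derivCoeffAux (z : ℂ) : Fin (n + 1) → ℂ :=
  update (derivCoeff n z) (linearIndex n hn) 0

theorem conj_derivCoeffAux_mul (z : ℂ) {d : Fin (n + 1) → ℂ} (hd : d (linearIndex n hn) = 0)
    (j : Fin (n + 1)) :
    conj (derivCoeffAux hn z j) * d j = conj (derivCoeff n z j) * d j := by
  by_cases h : j = linearIndex n hn
  · subst h; simp [hd]
  · rw [derivCoeffAux, update_of_ne h]

theorem sum_conj_derivCoeffAux_mul_self (z : ℂ) :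
    ∑ j, conj (derivCoeffAux hn z j) * derivCoeffAux hn z j
      = ∑ j, conj (derivCoeff n z j) * derivCoeff n z j - n := by
  rw [← Finset.add_sum_erase _ _ (Finset.mem_univ (linearIndex n hn)),
    ← Finset.add_sum_erase (a := linearIndex n hn) (f := fun j => conj (derivCoeff n z j) * _) _
      (Finset.mem_univ _)]
  have h : ∀ j ∈ Finset.univ.erase (linearIndex n hn),
      conj (derivCoeffAux hn z j) * derivCoeffAux hn z j
        = conj (derivCoeff n z j) * derivCoeff n z j := fun j hj => by
    rw [derivCoeffAux, update_of_ne (Finset.ne_of_mem_erase hj)]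
  rw [Finset.sum_congr rfl h, derivCoeff_linearIndex, derivCoeffAux, update_self,
    Complex.conj_ofReal, ← Complex.ofReal_mul, Real.mul_self_sqrt (by positivity)]
  simp

theorem sum_update_mul (c a : Fin (n + 1) → ℂ) (i : Fin (n + 1)) (w : ℂ) :
    ∑ j, c j * update a i w j = c i * w + ∑ j, update c i 0 j * a j := by
  rw [← Finset.add_sum_erase _ _ (Finset.mem_univ i),
    ← Finset.add_sum_erase (a := i) (f := fun j => update c i 0 j * a j) _ (Finset.mem_univ _)]
  simp only [update_self, zero_mul, zero_add]
  congr 1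
  refine Finset.sum_congr rfl fun j hj => ?_
  rw [update_of_ne (Finset.ne_of_mem_erase hj), update_of_ne (Finset.ne_of_mem_erase hj)]

theorem sum_update_mul_of_eq_zero {c : Fin (n + 1) → ℂ} {i : Fin (n + 1)} (hc : c i = 0)
    (a : Fin (n + 1) → ℂ) (w : ℂ) : ∑ j, c j * update a i w j = ∑ j, c j * a j := by
  rw [sum_update_mul, hc, zero_mul, zero_add, ← hc, update_eq_self]

/-- The inverse variance of `p(z)` given that `p'(z) = 0`. -/
noncomputable def invVar (n : ℕ) (z : ℂ) : ℝ := (1 + n * ‖z‖ ^ 2) / (1 + ‖z‖ ^ 2) ^ n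

/-- The regression coefficient of `p''(z)` on `p(z)` given that `p'(z) = 0`. -/
noncomputable def regCoeff (n : ℕ) (z : ℂ) : ℂ :=
  -(n * (n - 1)) * conj z ^ 2 / (1 + conj z * z) ^ 2

/-- The variance of `p''(z)` given `p(z)` and `p'(z)`. -/
noncomputable def resVar (n : ℕ) (z : ℂ) : ℝ :=
  2 * n * (n - 1) * ((1 + ‖z‖ ^ 2) ^ n / (1 + ‖z‖ ^ 2) ^ 4)

theorem invVar_pos (n : ℕ) (z : ℂ) : 0 < invVar n z := by unfold invVar; positivity

theorem resVar_nonneg {n : ℕ} (hn : 1 ≤ n) (z : ℂ) : 0 ≤ resVar n z := by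
  have : (0 : ℝ) ≤ n - 1 := by
    rw [sub_nonneg]; exact_mod_cast hn
  unfold resVar; positivity

/-- The leading `1` restores exactly the missing contribution of $a_1$, so the quantity is $\mathbb
E|p'(z)|^2/n$. -/
theorem one_add_sum_derivCoeffAux (z : ℂ) :
    1 + ((1 / n : ℝ) : ℂ) * ∑ j, conj (derivCoeffAux hn z j) * derivCoeffAux hn z j
      = (1 + n * (conj z * z)) * (1 + conj z * z) ^ n / (1 + conj z * z) ^ 2 := by
  have hr := one_add_normSq_ne_zero z
  have hn0 : (n : ℂ) ≠ 0 := by exact_mod_cast (by omega : n ≠ 0)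
  rw [sum_conj_derivCoeffAux_mul_self]
  simp only [conj_derivCoeff_mul_derivCoeff, Finset.sum_add_distrib, ← Finset.mul_sum,
    sum_momentTerm, cast_descFactorial_succ, Nat.descFactorial_zero]
  generalize hR : (1 + conj z * z) ^ n = R
  generalize conj z = y at *
  push_cast
  field_simp
  ring

/-- The weight is, up to a constant, the density of $a_1$ at the value forcing $p'(z)=0$. The
conditional law of $(p,p'')$ at $z$ is therefore a Gaussian regression, up to total mass. -/
theorem map_tangent_deriv2_eq (z : ℂ) :
    ((Measure.pi (fun _ : Fin (n + 1) => stdComplexGaussian)).withDensity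
        fun a => ENNReal.ofReal (Real.exp (-(1 / n * ‖∑ j, derivCoeffAux hn z j * a j‖ ^ 2)))).map
        (fun a => (∑ j, tangentCoeff n z j * a j, ∑ j, deriv2Coeff n z j * a j))
      = ENNReal.ofReal (1 + 1 / n * ∑ j, ‖derivCoeffAux hn z j‖ ^ 2)⁻¹ •
        ((complexGaussian (invVar n z)).prod stdComplexGaussian).map
          (fun x => (x.1, regCoeff n z * x.1 + Real.sqrt (resVar n z) * x.2)) := by
  have hr := one_add_normSq_ne_zero z
  have hs := one_add_nat_mul_normSq_ne_zero n z
  have hn0 : (n : ℂ) ≠ 0 := by exact_mod_cast (by omega : n ≠ 0)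
  have hR0 : (1 + conj z * z) ^ n ≠ 0 := pow_ne_zero _ hr
  have hA : ((invVar n z : ℝ) : ℂ) = (1 + n * (conj z * z)) / (1 + conj z * z) ^ n := by
    simp [invVar, Complex.conj_mul']
  have hV : ((Real.sqrt (resVar n z) : ℝ) : ℂ) ^ 2
      = 2 * n * (n - 1) * ((1 + conj z * z) ^ n / (1 + conj z * z) ^ 4) := by
    rw [← Complex.ofReal_pow, Real.sq_sqrt (resVar_nonneg hn z)]
    simp [resVar, Complex.conj_mul']
  refine map_withDensity_pi_eq (by positivity) (invVar_pos n z) _ _ _ _ ?_ ?_ ?_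
  all_goals
    rw [one_add_sum_derivCoeffAux]
    simp only [conj_derivCoeffAux_mul hn z (tangentCoeff_linearIndex hn z),
      conj_derivCoeffAux_mul hn z (deriv2Coeff_linearIndex hn z),
      conj_tangentCoeff_mul_tangentCoeff, conj_tangentCoeff_mul_deriv2Coeff,
      conj_derivCoeff_mul_tangentCoeff, conj_derivCoeff_mul_deriv2Coeff,
      conj_deriv2Coeff_mul_deriv2Coeff, Finset.sum_add_distrib, Finset.sum_sub_distrib,
      ← Finset.mul_sum,
      sum_momentTerm, cast_descFactorial_succ, Nat.descFactorial_zero, hA, hV, regCoeff, map_mul,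
      map_add, map_neg, map_div₀, map_pow, map_sub, map_one, map_natCast, Complex.conj_conj,
      map_ofNat, mul_comm z (conj z)]
    -- With the power, the conjugate and the second denominator as independent variables, each
    -- covariance identity becomes rational.
    generalize hR : (1 + conj z * z) ^ n = R at *
    generalize conj z = y at *
    generalize hQ : 1 + (n : ℂ) * (y * z) = Q at *
    push_cast
    field_simp
    rw [← hQ]
    ring

end LinearCoeff

/-! ### Joint continuity in the point and the coefficients -/

section Continuity

variable (n : ℕ)

theorem continuous_sum_evalCoeff :
    Continuous fun x : ℂ × (Fin (n + 1) → ℂ) => ∑ j, evalCoeff n x.1 j * x.2 j := by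
  simp only [evalCoeff]; fun_prop

theorem continuous_sum_derivCoeff :
    Continuous fun x : ℂ × (Fin (n + 1) → ℂ) => ∑ j, derivCoeff n x.1 j * x.2 j := by
  simp only [derivCoeff]; fun_prop

theorem continuous_sum_deriv2Coeff :
    Continuous fun x : ℂ × (Fin (n + 1) → ℂ) => ∑ j, deriv2Coeff n x.1 j * x.2 j := by
  simp only [deriv2Coeff]; fun_prop

theorem continuous_sum_tangentCoeff :
    Continuous fun x : ℂ × (Fin (n + 1) → ℂ) => ∑ j, tangentCoeff n x.1 j * x.2 j := by
  simp only [tangentCoeff, evalCoeff, derivCoeff]; fun_prop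

theorem continuous_sum_derivCoeffAux {n : ℕ} (hn : 1 ≤ n) :
    Continuous fun x : ℂ × (Fin (n + 1) → ℂ) => ∑ j, derivCoeffAux hn x.1 j * x.2 j := by
  have : (fun x : ℂ × (Fin (n + 1) → ℂ) => ∑ j, derivCoeffAux hn x.1 j * x.2 j)
      = fun x => ∑ j, derivCoeff n x.1 j * x.2 j
        - derivCoeff n x.1 (linearIndex n hn) * x.2 (linearIndex n hn) := by
    ext x
    have := sum_update_mul (derivCoeff n x.1) x.2 (linearIndex n hn) (x.2 (linearIndex n hn))
    rw [update_eq_self] at this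
    rw [this, add_sub_cancel_left]
    rfl
  rw [this]
  refine (continuous_sum_derivCoeff n).sub ?_
  simp only [derivCoeff]; fun_prop

end Continuity

/-! ### The density contributed by one point of the plane -/

section FixedPoint

/-- The contribution of a critical point at `z` to the expected density of critical values. -/
noncomputable def critDensity (n : ℕ) (z x : ℂ) : ℝ :=
  (n - 1) / Real.pi ^ 2 * (Real.exp (-(invVar n z * ‖x‖ ^ 2)) *
    (2 / (1 + ‖z‖ ^ 2) ^ (n + 2)
      + n * (n - 1) * (‖z‖ ^ 2) ^ 2 * ‖x‖ ^ 2 / (1 + ‖z‖ ^ 2) ^ (2 * n + 2)))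

variable {n : ℕ} (hn : 1 ≤ n)

theorem one_add_sum_norm_derivCoeffAux (z : ℂ) :
    1 + 1 / n * ∑ j, ‖derivCoeffAux hn z j‖ ^ 2
      = (1 + n * ‖z‖ ^ 2) * (1 + ‖z‖ ^ 2) ^ n / (1 + ‖z‖ ^ 2) ^ 2 := by
  have h := one_add_sum_derivCoeffAux hn z
  simp only [Complex.conj_mul'] at h
  exact_mod_cast h

theorem critDensity_eq (z x : ℂ) :
    1 / (n * Real.pi) * ((1 + 1 / n * ∑ j, ‖derivCoeffAux hn z j‖ ^ 2)⁻¹ *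
      (invVar n z / Real.pi * Real.exp (-(invVar n z * ‖x‖ ^ 2)) *
        (‖regCoeff n z * x‖ ^ 2 + Real.sqrt (resVar n z) ^ 2))) = critDensity n z x := by
  have hn0 : (n : ℝ) ≠ 0 := by exact_mod_cast (by omega : n ≠ 0)
  have hr : (1 + ‖z‖ ^ 2) ≠ 0 := by positivity
  have hs : (1 + n * ‖z‖ ^ 2) ≠ 0 := by positivity
  have hβ : ‖regCoeff n z * x‖ ^ 2
      = (n * (n - 1)) ^ 2 * (‖z‖ ^ 2) ^ 2 / (1 + ‖z‖ ^ 2) ^ 4 * ‖x‖ ^ 2 := by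
    have h1 : (n * (n - 1) : ℂ) = ((n * (n - 1) : ℝ) : ℂ) := by push_cast; rfl
    have h2 : (1 + conj z * z : ℂ) = ((1 + ‖z‖ ^ 2 : ℝ) : ℂ) := by
      rw [Complex.conj_mul']; push_cast; rfl
    rw [regCoeff, h1, h2, norm_mul, norm_div, norm_mul, norm_neg, norm_pow, norm_pow,
      Complex.norm_real, Complex.norm_real, RCLike.norm_conj, Real.norm_eq_abs, Real.norm_eq_abs,
      mul_pow, div_pow, mul_pow, sq_abs, sq_abs]
    ring
  rw [one_add_sum_norm_derivCoeffAux, hβ, Real.sq_sqrt (resVar_nonneg hn z), critDensity]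
  have e : invVar n z / Real.pi * Real.exp (-(invVar n z * ‖x‖ ^ 2))
      = (1 + n * ‖z‖ ^ 2) / (1 + ‖z‖ ^ 2) ^ n / Real.pi *
        Real.exp (-(invVar n z * ‖x‖ ^ 2)) := by rw [invVar]
  rw [e, resVar, pow_add, pow_add _ (2 * n), mul_comm 2 n, pow_mul]
  generalize Real.exp (-(invVar n z * ‖x‖ ^ 2)) = E
  have hR0 : (1 + ‖z‖ ^ 2) ^ n ≠ 0 := pow_ne_zero _ hr
  generalize (1 + ‖z‖ ^ 2) ^ n = R at *
  generalize 1 + (n : ℝ) * ‖z‖ ^ 2 = Q at *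
  field_simp
  ring

/-- Transfer to the regression model `(x, βx + τb)` and integrate out `b`, which replaces $|p''|^2$
by $|\beta x|^2+\tau^2$. -/
theorem lintegral_fixedPoint (z : ℂ) {B : Set ℂ} (hB : MeasurableSet B) :
    ∫⁻ a, ENNReal.ofReal (1 / (n * Real.pi) *
          Real.exp (-(1 / n * ‖∑ j, derivCoeffAux hn z j * a j‖ ^ 2))) *
        (ENNReal.ofReal (‖∑ j, deriv2Coeff n z j * a j‖ ^ 2) *
          B.indicator 1 (∑ j, tangentCoeff n z j * a j))
        ∂Measure.pi (fun _ : Fin (n + 1) => stdComplexGaussian)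
      = ∫⁻ x in B, ENNReal.ofReal (critDensity n z x) := by
  have hB1 : Measurable (B.indicator (1 : ℂ → ℝ≥0∞)) := measurable_one.indicator hB
  let F : ℂ × ℂ → ℝ≥0∞ := fun y => ENNReal.ofReal (‖y.2‖ ^ 2) * B.indicator 1 y.1
  have hF : Measurable F := by fun_prop
  have h := congrArg (fun ν => ∫⁻ y, F y ∂ν) (map_tangent_deriv2_eq hn z)
  beta_reduce at h
  have := isProbabilityMeasure_complexGaussian (invVar_pos n z)
  rw [lintegral_map hF (by fun_prop), lintegral_smul_measure, lintegral_map hF (by fun_prop),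
    lintegral_withDensity_eq_lintegral_mul _ (by fun_prop) (by fun_prop),
    lintegral_prod _ (by fun_prop)] at h
  simp only [F, Pi.mul_apply] at h
  have hA := invVar_pos n z
  have e1 : ∀ x : ℂ, ∫⁻ y, ENNReal.ofReal (‖regCoeff n z * x + Real.sqrt (resVar n z) * y‖ ^ 2) *
        B.indicator 1 x ∂stdComplexGaussian
      = ENNReal.ofReal (‖regCoeff n z * x‖ ^ 2 + Real.sqrt (resVar n z) ^ 2) *
        B.indicator 1 x := fun x => by
    rw [lintegral_mul_const _ (by fun_prop), lintegral_sq_norm_add_stdComplexGaussian]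
  simp_rw [e1] at h
  have e2 : ∀ a : Fin (n + 1) → ℂ, ENNReal.ofReal (1 / (n * Real.pi) *
          Real.exp (-(1 / n * ‖∑ j, derivCoeffAux hn z j * a j‖ ^ 2))) *
        (ENNReal.ofReal (‖∑ j, deriv2Coeff n z j * a j‖ ^ 2) *
          B.indicator 1 (∑ j, tangentCoeff n z j * a j))
      = ENNReal.ofReal (1 / (n * Real.pi)) * (ENNReal.ofReal (
          Real.exp (-(1 / n * ‖∑ j, derivCoeffAux hn z j * a j‖ ^ 2))) *
        (ENNReal.ofReal (‖∑ j, deriv2Coeff n z j * a j‖ ^ 2) *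
          B.indicator 1 (∑ j, tangentCoeff n z j * a j))) := fun a => by
    rw [ENNReal.ofReal_mul (by positivity), mul_assoc]
  simp_rw [e2]
  rw [lintegral_const_mul _ (by fun_prop), h, complexGaussian,
    lintegral_withDensity_eq_lintegral_mul _ (by fun_prop) (by fun_prop), smul_eq_mul,
    ← lintegral_const_mul _ (by fun_prop), ← lintegral_const_mul _ (by fun_prop),
    ← lintegral_indicator hB]
  refine lintegral_congr fun x => ?_
  rw [Pi.mul_apply]
  by_cases hx : x ∈ B
  · have hS : 0 ≤ 1 + 1 / n * ∑ j, ‖derivCoeffAux hn z j‖ ^ 2 := by positivity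
    rw [indicator_of_mem hx, indicator_of_mem hx, Pi.one_apply, mul_one,
      ← ENNReal.ofReal_mul (by positivity), ← ENNReal.ofReal_mul (by positivity),
      ← ENNReal.ofReal_mul (by positivity), critDensity_eq]
  · simp [hx]

end FixedPoint

/-! ### The empirical measure of nondegenerate critical values -/

section CriticalMeasure

/-- The nondegenerate critical points of `p`. -/
def nondegCrit (n : ℕ) (a : Fin (n + 1) → ℂ) : Set ℂ :=
  {z | ∑ j, derivCoeff n z j * a j = 0 ∧ ∑ j, deriv2Coeff n z j * a j ≠ 0}

/-- The empirical measure of the values of `p` at its nondegenerate critical points. -/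
noncomputable def critMeasure (n : ℕ) (a : Fin (n + 1) → ℂ) : Measure ℂ :=
  (Measure.count.restrict (nondegCrit n a)).map fun z => ∑ j, evalCoeff n z j * a j

variable {n : ℕ}

theorem measurable_sum_evalCoeff (a : Fin (n + 1) → ℂ) :
    Measurable fun z => ∑ j, evalCoeff n z j * a j :=
  ((continuous_sum_evalCoeff n).comp (by fun_prop : Continuous fun z => (z, a))).measurable

theorem critMeasure_apply (a : Fin (n + 1) → ℂ) {B : Set ℂ} (hB : MeasurableSet B) :
    critMeasure n a B
      = Measure.count ({z | ∑ j, evalCoeff n z j * a j ∈ B} ∩ nondegCrit n a) := by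
  rw [critMeasure, Measure.map_apply (measurable_sum_evalCoeff a) hB,
    Measure.restrict_apply (measurable_sum_evalCoeff a hB)]
  rfl

/-- Nondegenerate critical points are locally unique, locally uniformly in the polynomial. -/
theorem exists_isOpen_injOn_snd (x : ℂ × (Fin (n + 1) → ℂ)) (hx : x.1 ∈ nondegCrit n x.2) :
    ∃ O : Set (ℂ × (Fin (n + 1) → ℂ)), IsOpen O ∧ x ∈ O ∧
      InjOn Prod.snd (O ∩ {y | y.1 ∈ nondegCrit n y.2}) := by
  -- `G` is the divided difference of $p'$, continuous also in the coefficients and equal to $p''$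
  -- on the diagonal. Where it is nonzero, two critical points of the same polynomial must coincide.
  obtain ⟨G, hG, hG1, hG2⟩ : ∃ G : ℂ → ℂ → (Fin (n + 1) → ℂ) → ℂ,
      Continuous (fun y : (ℂ × (Fin (n + 1) → ℂ)) × (ℂ × (Fin (n + 1) → ℂ)) =>
        G y.1.1 y.2.1 y.1.2) ∧
      (∀ z w a, G z w a * (z - w)
        = ∑ j, derivCoeff n z j * a j - ∑ j, derivCoeff n w j * a j) ∧
      ∀ z a, G z z a = ∑ j, deriv2Coeff n z j * a j := by
    refine ⟨fun z w a => ∑ j : Fin (n + 1),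
      (Real.sqrt (n.choose j : ℝ) : ℂ) * ((j : ℕ) * ∑ i ∈ Finset.range ((j : ℕ) - 1),
        z ^ i * w ^ ((j : ℕ) - 1 - 1 - i)) * a j, by fun_prop, fun z w a => ?_, fun z a => ?_⟩
    · rw [← Finset.sum_sub_distrib, Finset.sum_mul]
      refine Finset.sum_congr rfl fun j _ => ?_
      have := geom_sum₂_mul z w ((j : ℕ) - 1)
      simp only [derivCoeff]
      linear_combination (Real.sqrt (n.choose j : ℝ) : ℂ) * (j : ℕ) * a j * this
    · refine Finset.sum_congr rfl fun j _ => ?_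
      rw [geom_sum₂_self, deriv2Coeff]
  have hmem : {y : (ℂ × (Fin (n + 1) → ℂ)) × (ℂ × (Fin (n + 1) → ℂ)) |
      G y.1.1 y.2.1 y.1.2 ≠ 0} ∈ 𝓝 (x, x) := by
    refine (isOpen_ne_fun hG continuous_const).mem_nhds ?_
    simpa only [mem_ofPred_eq, hG2] using hx.2
  rw [nhds_prod_eq, Filter.mem_prod_same_iff] at hmem
  obtain ⟨V, hV, hVsub⟩ := hmem
  obtain ⟨O, hOV, hO, hxO⟩ := mem_nhds_iff.1 hV
  refine ⟨O, hO, hxO, ?_⟩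
  rintro ⟨z, a⟩ ⟨hz, hzc⟩ ⟨w, b⟩ ⟨hw, hwc⟩ hab
  obtain rfl : a = b := hab
  have h := hG1 z w a
  rw [hzc.1, hwc.1, sub_zero, mul_eq_zero, sub_eq_zero] at h
  rcases h with h | h
  · exact absurd h (hVsub (mk_mem_prod (hOV hz) (hOV hw)))
  · simp [h]

theorem measurableSet_nondegCrit :
    MeasurableSet {y : ℂ × (Fin (n + 1) → ℂ) | y.1 ∈ nondegCrit n y.2} :=
  ((continuous_sum_derivCoeff n).measurable (measurableSet_singleton 0)).inter
    ((continuous_sum_deriv2Coeff n).measurable (measurableSet_singleton 0)).compl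

/-- Critical points of $p_a$ form the fibre over $a$ of the projection from the incidence set, which
is locally injective there. -/
theorem measurable_critMeasure : Measurable (critMeasure n) := by
  refine Measure.measurable_of_measurable_coe _ fun B hB => ?_
  have hE : MeasurableSet {y : ℂ × (Fin (n + 1) → ℂ) | ∑ j, evalCoeff n y.1 j * y.2 j ∈ B} :=
    (continuous_sum_evalCoeff n).measurable hB
  have h := measurable_lintegral_count_fibre (Φ := Prod.snd) measurable_snd
    (measurableSet_nondegCrit (n := n)) exists_isOpen_injOn_snd
    (measurable_const.indicator hE : Measurable (indicator _ fun _ => (1 : ℝ≥0∞)))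
  convert h using 1
  ext a
  have hinj : Injective fun z : ℂ => (z, a) := fun z w h => by simpa using h
  rw [critMeasure_apply a hB, lintegral_indicator_const hE, one_mul, Measure.restrict_apply hE,
    ← Measure.count_injective_image hinj]
  congr 1
  ext ⟨z, b⟩
  simp only [mem_inter_iff, mem_ofPred_eq, mem_preimage, mem_singleton_iff, mem_image,
    Prod.mk.injEq]
  constructor
  · rintro ⟨w, ⟨h1, h2⟩, rfl, rfl⟩
    exact ⟨h1, h2, rfl⟩
  · rintro ⟨h1, h2, rfl⟩
    exact ⟨z, ⟨h1, h2⟩, rfl, rfl⟩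

/-- The bound needs no exception for $p'=0$: then $p''=0$, so there are no nondegenerate critical
points. -/
theorem critMeasure_univ_le (a : Fin (n + 1) → ℂ) : critMeasure n a univ ≤ n := by
  rw [critMeasure_apply a MeasurableSet.univ]
  simp only [mem_univ, ofPred_true, univ_inter]
  by_cases hp : (poly n a).derivative = 0
  · have : nondegCrit n a = ∅ := by
      ext z
      simp only [nondegCrit, mem_ofPred_eq, mem_empty_iff_false, iff_false, not_and, not_not]
      intro _
      rw [← eval_derivative2_poly, hp]; simp
    simp [this]
  · have hsub : nondegCrit n a ⊆ ((poly n a).derivative.roots.toFinset : Set ℂ) := by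
      intro z hz
      rw [Finset.mem_coe, Multiset.mem_toFinset, mem_roots hp, IsRoot.def, eval_derivative_poly]
      exact hz.1
    refine (measure_mono hsub).trans ?_
    rw [Measure.count_apply_finset]
    have hdeg : (poly n a).natDegree ≤ n := by
      refine natDegree_sum_le_of_forall_le _ _ fun j _ => ?_
      exact (natDegree_C_mul_X_pow_le _ _).trans (Nat.lt_succ_iff.1 j.2)
    have : (poly n a).derivative.roots.toFinset.card ≤ n :=
      (Multiset.toFinset_card_le _).trans ((card_roots' _).trans
        ((natDegree_derivative_le _).trans ((Nat.sub_le _ _).trans hdeg)))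
    exact_mod_cast this

/-- If all critical points are nondegenerate, the two empirical measures agree. -/
theorem critMeasure_eq_criticalValueMeasure {a : Fin (n + 1) → ℂ}
    (ha : ∀ z, ∑ j, derivCoeff n z j * a j = 0 → ∑ j, deriv2Coeff n z j * a j ≠ 0) :
    criticalValueMeasure (poly n a) = critMeasure n a := by
  ext B hB
  have hset : {z | ∑ j, evalCoeff n z j * a j ∈ B} ∩ nondegCrit n a
      = {z | (poly n a).derivative.eval z = 0} ∩ {z | (poly n a).eval z ∈ B} := by
    ext z
    simp only [nondegCrit, mem_inter_iff, mem_ofPred_eq, eval_derivative_poly, eval_poly]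
    exact ⟨fun h => ⟨h.2.1, h.1⟩, fun h => ⟨h.2, h.1, ha z h.1⟩⟩
  have hS : MeasurableSet {z | (poly n a).derivative.eval z = 0} :=
    (isClosed_eq (poly n a).derivative.continuous continuous_const).measurableSet
  have hV : MeasurableSet {z | (poly n a).eval z ∈ B} := (poly n a).continuous.measurable hB
  rw [critMeasure_apply a hB, hset, criticalValueMeasure, Measure.sum_apply _ hB,
    Measure.count, Measure.sum_apply _ (hS.inter hV)]
  simp_rw [Measure.dirac_apply' _ hB, Measure.dirac_apply' _ (hS.inter hV), ← indicator_indicator]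
  exact tsum_subtype {z | (poly n a).derivative.eval z = 0}
    ({z | (poly n a).eval z ∈ B}.indicator 1)

end CriticalMeasure

/-! ### Resampling the linear coefficient and the Kac–Rice formula -/

/-- Resampling one coordinate of an i.i.d. vector preserves its law. -/
theorem measurePreserving_update {ι α : Type*} [Fintype ι] [DecidableEq ι] [MeasurableSpace α]
    (μ : Measure α) [IsProbabilityMeasure μ] (i : ι) :
    MeasurePreserving (fun x : (ι → α) × α => update x.1 i x.2)
      ((Measure.pi fun _ => μ).prod μ) (Measure.pi fun _ => μ) := by
  have hm : Measurable fun x : (ι → α) × α => update x.1 i x.2 := by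
    refine measurable_pi_lambda _ fun j => ?_
    by_cases h : j = i
    · subst h; simpa using measurable_snd
    · simpa [update_of_ne h] using (measurable_pi_apply j).fun_comp measurable_fst
  refine ⟨hm, (Measure.pi_eq fun s hs => ?_).symm⟩
  rw [Measure.map_apply hm (MeasurableSet.univ_pi hs)]
  have hpre : (fun x : (ι → α) × α => update x.1 i x.2) ⁻¹' univ.pi s
      = (univ.pi (update s i univ)) ×ˢ s i := by
    ext ⟨a, w⟩
    simp only [mem_preimage, mem_pi, mem_univ, true_imp_iff, mem_prod]
    constructor
    · refine fun h => ⟨fun j => ?_, by simpa using h i⟩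
      by_cases hj : j = i
      · subst hj; simp
      · simpa [update_of_ne hj] using h j
    · rintro ⟨h1, h2⟩ j
      by_cases hj : j = i
      · subst hj; simpa using h2
      · simpa [update_of_ne hj] using h1 j
  rw [hpre, Measure.prod_prod, Measure.pi_pi, ← Finset.mul_prod_erase _ _ (Finset.mem_univ i),
    ← Finset.mul_prod_erase _ (fun j => μ (s j)) (Finset.mem_univ i), update_self, measure_univ,
    one_mul, mul_comm]
  congr 1
  exact Finset.prod_congr rfl fun j hj => by rw [update_of_ne (Finset.ne_of_mem_erase hj)]

theorem lintegral_pi_eq_lintegral_update {ι α : Type*} [Fintype ι] [DecidableEq ι]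
    [MeasurableSpace α] (μ : Measure α) [IsProbabilityMeasure μ] (i : ι) {f : (ι → α) → ℝ≥0∞}
    (hf : Measurable f) :
    ∫⁻ a, f a ∂Measure.pi (fun _ => μ)
      = ∫⁻ a, ∫⁻ w, f (update a i w) ∂μ ∂Measure.pi (fun _ => μ) := by
  have h := measurePreserving_update μ i
  have hfu : Measurable fun x : (ι → α) × α => f (update x.1 i x.2) := hf.fun_comp h.measurable
  rw [← lintegral_prod _ hfu.aemeasurable, ← lintegral_map hf h.measurable, h.map_eq]

section SolveLinear

variable {n : ℕ} (hn : 1 ≤ n) (a : Fin (n + 1) → ℂ)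

/-- The linear coefficient for which `z` is a critical point, as a function of `z` and of the other
coefficients. -/
noncomputable def solveLinear (z : ℂ) : ℂ :=
  -(∑ j, derivCoeffAux hn z j * a j) / (Real.sqrt n : ℂ)

theorem sqrt_natCast_ne_zero {n : ℕ} (hn : 1 ≤ n) : (Real.sqrt n : ℂ) ≠ 0 := by
  have : 0 < Real.sqrt n := Real.sqrt_pos.2 (by exact_mod_cast hn)
  exact_mod_cast this.ne'

theorem sum_derivCoeff_update_eq_zero_iff (z w : ℂ) :
    ∑ j, derivCoeff n z j * update a (linearIndex n hn) w j = 0 ↔ solveLinear hn a z = w := by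
  have h := sqrt_natCast_ne_zero hn
  rw [sum_update_mul, derivCoeff_linearIndex, solveLinear, div_eq_iff h]
  change _ + ∑ j, derivCoeffAux hn z j * a j = 0 ↔ _
  constructor
  · intro h'; linear_combination -h'
  · intro h'; linear_combination -h'

theorem hasStrictDerivAt_derivCoeff (z : ℂ) (j : Fin (n + 1)) :
    HasStrictDerivAt (fun z => derivCoeff n z j) (deriv2Coeff n z j) z := by
  simp only [derivCoeff, deriv2Coeff]
  exact ((hasStrictDerivAt_pow _ _).const_mul _).const_mul _

theorem hasStrictDerivAt_solveLinear (z : ℂ) :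
    HasStrictDerivAt (solveLinear hn a)
      (-(∑ j, deriv2Coeff n z j * a j) / (Real.sqrt n : ℂ)) z := by
  refine HasStrictDerivAt.div_const (HasStrictDerivAt.neg ?_) _
  refine HasStrictDerivAt.fun_sum fun j _ => HasStrictDerivAt.mul_const ?_ _
  by_cases h : j = linearIndex n hn
  · subst h
    rw [deriv2Coeff_linearIndex]
    simp only [derivCoeffAux, update_self]
    exact hasStrictDerivAt_const _ _
  · simp only [derivCoeffAux, update_of_ne h]
    exact hasStrictDerivAt_derivCoeff z j

/-- Almost surely, every critical point is nondegenerate. -/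
theorem ae_nondegenerate (hn : 1 ≤ n) :
    ∀ᵐ a ∂Measure.pi (fun _ : Fin (n + 1) => stdComplexGaussian),
      ∀ z, ∑ j, derivCoeff n z j * a j = 0 → ∑ j, deriv2Coeff n z j * a j ≠ 0 := by
  set bad : Set (Fin (n + 1) → ℂ) := Prod.snd '' ({x : ℂ × (Fin (n + 1) → ℂ) |
    ∑ j, derivCoeff n x.1 j * x.2 j = 0} ∩ {x | ∑ j, deriv2Coeff n x.1 j * x.2 j = 0}) with hbad
  have hmem : ∀ a, a ∈ bad ↔
      ∃ z, ∑ j, derivCoeff n z j * a j = 0 ∧ ∑ j, deriv2Coeff n z j * a j = 0 := by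
    intro a
    rw [hbad]
    constructor
    · rintro ⟨⟨z, b⟩, ⟨h1, h2⟩, rfl⟩
      exact ⟨z, h1, h2⟩
    · rintro ⟨z, h1, h2⟩
      exact ⟨(z, a), ⟨h1, h2⟩, rfl⟩
  have hclosed : IsClosed ({x : ℂ × (Fin (n + 1) → ℂ) |
      ∑ j, derivCoeff n x.1 j * x.2 j = 0} ∩ {x | ∑ j, deriv2Coeff n x.1 j * x.2 j = 0}) :=
    (isClosed_eq (continuous_sum_derivCoeff n) continuous_const).inter
      (isClosed_eq (continuous_sum_deriv2Coeff n) continuous_const)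
  have hmeas : MeasurableSet bad := by
    -- The bad set is a projection of a closed set, hence a countable union of compacts and Borel.
    obtain ⟨K, hK, hKU⟩ := (isSigmaCompact_univ.of_isClosed_subset hclosed (subset_univ _)).image
      continuous_snd
    rw [hbad, ← hKU]
    exact MeasurableSet.iUnion fun i => (hK i).measurableSet
  have hnull : Measure.pi (fun _ : Fin (n + 1) => stdComplexGaussian) bad = 0 := by
    rw [← lintegral_indicator_one hmeas,
      lintegral_pi_eq_lintegral_update _ (linearIndex n hn) (measurable_one.indicator hmeas)]
    refine (lintegral_congr fun a => ?_).trans lintegral_zero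
    -- A value of $a_1$ creating a degenerate critical point is a critical value of `solveLinear`,
    -- so Sard's theorem applies.
    have hs : {w | update a (linearIndex n hn) w ∈ bad} ⊆
        solveLinear hn a '' {z | -(∑ j, deriv2Coeff n z j * a j) / (Real.sqrt n : ℂ) = 0} := by
      intro w hw
      obtain ⟨z, h1, h2⟩ := (hmem _).1 hw
      rw [sum_update_mul_of_eq_zero (deriv2Coeff_linearIndex hn z)] at h2
      exact ⟨z, by simp [h2], (sum_derivCoeff_update_eq_zero_iff hn a z w).1 h1⟩
    have h0 : stdComplexGaussian {w | update a (linearIndex n hn) w ∈ bad} = 0 :=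
      withDensity_absolutelyContinuous _ _ (measure_mono_null hs (volume_image_deriv_eq_zero
        fun z => (hasStrictDerivAt_solveLinear hn a z).hasDerivAt))
    rw [lintegral_eq_zero_iff ((measurable_one.indicator hmeas).fun_comp (measurable_update a))]
    filter_upwards [measure_eq_zero_iff_ae_notMem.1 h0] with w hw
    exact indicator_of_notMem hw _
  filter_upwards [measure_eq_zero_iff_ae_notMem.1 hnull] with a ha z h1 h2
  exact ha ((hmem a).2 ⟨z, h1, h2⟩)

/-- Nondegenerate critical points are the regular points in the fibre of `solveLinear` over `w`, and
on that fibre $p=p-zp'$ does not depend on `w`. -/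
theorem critMeasure_update_apply (w : ℂ) {B : Set ℂ} (hB : MeasurableSet B) :
    critMeasure n (update a (linearIndex n hn) w) B
      = ∫⁻ z in {z | -(∑ j, deriv2Coeff n z j * a j) / (Real.sqrt n : ℂ) ≠ 0} ∩
          solveLinear hn a ⁻¹' {w}, B.indicator 1 (∑ j, tangentCoeff n z j * a j)
          ∂Measure.count := by
  have ht : Measurable fun z => ∑ j, tangentCoeff n z j * a j :=
    ((continuous_sum_tangentCoeff n).comp (by fun_prop : Continuous fun z => (z, a))).measurable
  have hT : MeasurableSet {z | ∑ j, tangentCoeff n z j * a j ∈ B} := ht hB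
  have hi : ∀ z, B.indicator (1 : ℂ → ℝ≥0∞) (∑ j, tangentCoeff n z j * a j)
      = {z | ∑ j, tangentCoeff n z j * a j ∈ B}.indicator 1 z := fun z => rfl
  simp_rw [hi]
  rw [critMeasure_apply _ hB, lintegral_indicator_one hT, Measure.restrict_apply hT]
  congr 1
  ext z
  have hd := sum_update_mul_of_eq_zero (deriv2Coeff_linearIndex hn z) a w
  have htan := sum_update_mul_of_eq_zero (tangentCoeff_linearIndex hn z) a w
  have hz := sum_derivCoeff_update_eq_zero_iff hn a z w
  have hsq := sqrt_natCast_ne_zero hn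
  simp only [nondegCrit, mem_inter_iff, mem_ofPred_eq, mem_preimage, mem_singleton_iff, hd, ← hz,
    ne_eq, div_eq_zero_iff, neg_eq_zero, hsq, or_false]
  have hev : ∑ j, derivCoeff n z j * update a (linearIndex n hn) w j = 0 →
      ∑ j, evalCoeff n z j * update a (linearIndex n hn) w j = ∑ j, tangentCoeff n z j * a j := by
    intro h
    rw [← htan]
    simp only [tangentCoeff, sub_mul, Finset.sum_sub_distrib, mul_assoc, ← Finset.mul_sum, h,
      mul_zero, sub_zero]
  constructor
  · rintro ⟨h1, h2, h3⟩
    exact ⟨hev h2 ▸ h1, h3, h2⟩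
  · rintro ⟨h1, h2, h3⟩
    exact ⟨(hev h3).symm ▸ h1, h3, h2⟩

/-- The area formula for `solveLinear`: its Jacobian $|p''|^2/n$ and the Gaussian normalisation
$1/\pi$ give the constant $1/(n\pi)$. -/
theorem lintegral_critMeasure_update {B : Set ℂ} (hB : MeasurableSet B) :
    ∫⁻ w, critMeasure n (update a (linearIndex n hn) w) B ∂stdComplexGaussian
      = ∫⁻ z, ENNReal.ofReal (1 / (n * Real.pi) *
          Real.exp (-(1 / n * ‖∑ j, derivCoeffAux hn z j * a j‖ ^ 2))) *
        (ENNReal.ofReal (‖∑ j, deriv2Coeff n z j * a j‖ ^ 2) *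
          B.indicator 1 (∑ j, tangentCoeff n z j * a j)) := by
  have ht : Measurable fun z => ∑ j, tangentCoeff n z j * a j :=
    ((continuous_sum_tangentCoeff n).comp (by fun_prop : Continuous fun z => (z, a))).measurable
  have hd : Measurable fun z => -(∑ j, deriv2Coeff n z j * a j) / (Real.sqrt n : ℂ) :=
    (((continuous_sum_deriv2Coeff n).comp
      (by fun_prop : Continuous fun z => (z, a))).neg.div_const _).measurable
  have hB1 : Measurable (B.indicator (1 : ℂ → ℝ≥0∞)) := measurable_one.indicator hB
  have hs : Measurable (solveLinear hn a) :=
    (continuous_iff_continuousAt.2 fun z =>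
      (hasStrictDerivAt_solveLinear hn a z).hasDerivAt.continuousAt).measurable
  have hκ : Measurable fun w => critMeasure n (update a (linearIndex n hn) w) B :=
    (Measure.measurable_coe hB).comp (measurable_critMeasure.comp (measurable_update a))
  rw [stdComplexGaussian, lintegral_withDensity_eq_lintegral_mul _ (by fun_prop) hκ]
  have h1 : ∀ w, ((fun z : ℂ => ENNReal.ofReal (Real.pi⁻¹ * Real.exp (-‖z‖ ^ 2))) *
        fun w => critMeasure n (update a (linearIndex n hn) w) B) w
      = ∫⁻ z in {z | -(∑ j, deriv2Coeff n z j * a j) / (Real.sqrt n : ℂ) ≠ 0} ∩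
          solveLinear hn a ⁻¹' {w},
          ENNReal.ofReal (Real.pi⁻¹ * Real.exp (-‖solveLinear hn a z‖ ^ 2)) *
            B.indicator 1 (∑ j, tangentCoeff n z j * a j) ∂Measure.count := by
    intro w
    rw [Pi.mul_apply, critMeasure_update_apply hn a w hB, ← lintegral_const_mul _ (hB1.fun_comp ht)]
    have hm : MeasurableSet ({z | -(∑ j, deriv2Coeff n z j * a j) / (Real.sqrt n : ℂ) ≠ 0} ∩
        solveLinear hn a ⁻¹' {w}) :=
      (hd (measurableSet_singleton 0)).compl.inter (hs (measurableSet_singleton w))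
    refine setLIntegral_congr_fun hm fun z hz => ?_
    rw [← show solveLinear hn a z = w from hz.2]
  simp_rw [h1]
  rw [lintegral_lintegral_count_fibre (hasStrictDerivAt_solveLinear hn a) hd (by fun_prop)]
  refine lintegral_congr fun z => ?_
  have hn0 : (n : ℝ) ≠ 0 := by exact_mod_cast (by omega : n ≠ 0)
  have hsq : ‖(Real.sqrt n : ℂ)‖ ^ 2 = n := by
    rw [Complex.norm_real, Real.norm_eq_abs, sq_abs, Real.sq_sqrt (by positivity)]
  rw [solveLinear, ← mul_assoc, ← mul_assoc, ← ENNReal.ofReal_mul (by positivity),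
    ← ENNReal.ofReal_mul (by positivity), norm_div, norm_div, div_pow, div_pow, hsq, norm_neg,
    norm_neg]
  congr 2
  have : -(‖∑ j, derivCoeffAux hn z j * a j‖ ^ 2 / n)
      = -(1 / n * ‖∑ j, derivCoeffAux hn z j * a j‖ ^ 2) := by ring
  rw [this]
  field_simp

/-- The expected empirical measure of critical values, as an integral over the critical point. -/
theorem lintegral_critMeasure_apply {n : ℕ} (hn : 1 ≤ n) {B : Set ℂ} (hB : MeasurableSet B) :
    ∫⁻ a, critMeasure n a B ∂Measure.pi (fun _ : Fin (n + 1) => stdComplexGaussian)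
      = ∫⁻ z, ∫⁻ x in B, ENNReal.ofReal (critDensity n z x) := by
  rw [lintegral_pi_eq_lintegral_update _ (linearIndex n hn)
    ((Measure.measurable_coe hB).fun_comp measurable_critMeasure)]
  simp_rw [lintegral_critMeasure_update hn _ hB]
  rw [lintegral_lintegral_swap]
  · simp_rw [lintegral_fixedPoint hn _ hB]
  · have hB1 : Measurable (B.indicator (1 : ℂ → ℝ≥0∞)) := measurable_one.indicator hB
    have h1 := ((continuous_sum_derivCoeffAux hn).comp continuous_swap).measurable
    have h2 := ((continuous_sum_deriv2Coeff n).comp continuous_swap).measurable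
    have h3 := ((continuous_sum_tangentCoeff n).comp continuous_swap).measurable
    simp only [comp_def, Prod.fst_swap, Prod.snd_swap] at h1 h2 h3
    simp only [uncurry_def]
    exact Measurable.aemeasurable (by fun_prop)

end SolveLinear

/-! ### Reduction to a radial integral and integration by parts -/

section Radial

/-- The inverse conditional variance as a function of `r = 1 + |z|²`. -/
noncomputable def radialInvVar (n : ℕ) (r : ℝ) : ℝ := ((n : ℝ) * (r - 1) + 1) / r ^ n

/-- The contribution of the critical points with `1 + |z|² = r`, up to a constant. -/
noncomputable def radialDensity (n : ℕ) (x : ℂ) (r : ℝ) : ℝ :=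
  Real.exp (-(radialInvVar n r * ‖x‖ ^ 2)) *
    (2 / r ^ (n + 2) + n * (n - 1) * (r - 1) ^ 2 * ‖x‖ ^ 2 / r ^ (2 * n + 2))

/-- A primitive of the difference of the two expressions of the density. -/
noncomputable def radialPrimitive (n : ℕ) (x : ℂ) (r : ℝ) : ℝ :=
  -((r - 1) / r ^ (n + 1)) * Real.exp (-(radialInvVar n r * ‖x‖ ^ 2))

theorem critDensity_eq_radialDensity (n : ℕ) (z x : ℂ) :
    critDensity n z x = (n - 1) / Real.pi ^ 2 * radialDensity n x (1 + ‖z‖ ^ 2) := by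
  have h : invVar n z = radialInvVar n (1 + ‖z‖ ^ 2) := by
    rw [invVar, radialInvVar]; ring
  rw [critDensity, radialDensity, h, add_sub_cancel_left]

theorem radialInvVar_nonneg {n : ℕ} {r : ℝ} (hr : 1 ≤ r) : 0 ≤ radialInvVar n r := by
  have : 0 ≤ r - 1 := by linarith
  unfold radialInvVar; positivity

theorem exp_radialInvVar_le_one {n : ℕ} {r : ℝ} (hr : 1 ≤ r) (x : ℂ) :
    Real.exp (-(radialInvVar n r * ‖x‖ ^ 2)) ≤ 1 := by
  rw [Real.exp_le_one_iff, neg_nonpos]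
  exact mul_nonneg (radialInvVar_nonneg hr) (by positivity)

/-- The derivative of `radialInvVar` is $-n(n-1)(r-1)/r^{n+1}$, so differentiating the exponential
cancels the $|x|^2$ term; differentiating the prefactor turns $2$ into $n(r-1)+1$. -/
theorem hasDerivAt_radialPrimitive (n : ℕ) (x : ℂ) {r : ℝ} (hr : 0 < r) :
    HasDerivAt (radialPrimitive n x) (densityIntegrand n x r - radialDensity n x r) r := by
  have hr0 : r ≠ 0 := hr.ne'
  have h1 : HasDerivAt (radialInvVar n)
      ((n * r ^ n - (n * (r - 1) + 1) * (n * r ^ (n - 1))) / (r ^ n) ^ 2) r := by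
    refine HasDerivAt.fun_div ?_ (hasDerivAt_pow n r) (pow_ne_zero _ hr0)
    simpa using (((hasDerivAt_id r).sub_const 1).const_mul (n : ℝ)).add_const 1
  have h2 : HasDerivAt (fun r : ℝ => -((r - 1) / r ^ (n + 1)))
      (-((1 * r ^ (n + 1) - (r - 1) * ((n + 1 : ℕ) * r ^ n)) / (r ^ (n + 1)) ^ 2)) r := by
    refine HasDerivAt.fun_neg (HasDerivAt.fun_div ((hasDerivAt_id r).sub_const 1) ?_
      (pow_ne_zero _ hr0))
    simpa using hasDerivAt_pow (n + 1) r
  have h3 := h2.fun_mul ((h1.mul_const (‖x‖ ^ 2)).fun_neg.exp)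
  refine h3.congr_deriv ?_
  have hexp : densityIntegrand n x r = (n * (r - 1) + 1) / r ^ (n + 2) *
      Real.exp (-(radialInvVar n r * ‖x‖ ^ 2)) := rfl
  have hpow : (n : ℝ) * r ^ (n - 1) = n * (r ^ n / r) := by
    rcases n with _ | m
    · simp
    · rw [Nat.add_sub_cancel, pow_succ]; field_simp
  rw [hexp, radialDensity, hpow]
  generalize Real.exp (-(radialInvVar n r * ‖x‖ ^ 2)) = E
  have hR : r ^ n ≠ 0 := pow_ne_zero _ hr0
  rw [pow_add, pow_add, pow_add, mul_comm 2 n, pow_mul]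
  generalize r ^ n = R at *
  push_cast
  field_simp
  ring

theorem integrableOn_Ioi_of_le_inv_sq {f : ℝ → ℝ} (hf : ContinuousOn f (Ioi 1)) {c : ℝ}
    (hle : ∀ r, 1 < r → |f r| ≤ c / r ^ 2) : IntegrableOn f (Ioi 1) := by
  have h : IntegrableOn (fun r : ℝ => c * r ^ (-2 : ℝ)) (Ioi 1) :=
    (integrableOn_Ioi_rpow_of_lt (by norm_num) one_pos).const_mul c
  refine Integrable.mono' h (hf.aestronglyMeasurable measurableSet_Ioi) ?_
  refine (ae_restrict_iff' measurableSet_Ioi).2 (.of_forall fun r hr => ?_)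
  have hr0 : (0 : ℝ) < r := one_pos.trans hr
  rw [Real.norm_eq_abs, Real.rpow_neg hr0.le, Real.rpow_ofNat, ← div_eq_mul_inv]
  exact hle r hr

theorem continuousOn_radialInvVar (n : ℕ) : ContinuousOn (radialInvVar n) (Ioi 1) := by
  unfold radialInvVar
  exact ContinuousOn.div (by fun_prop) (by fun_prop)
    fun r hr => pow_ne_zero _ (one_pos.trans hr).ne'

theorem continuousOn_exp_radialInvVar (n : ℕ) (x : ℂ) :
    ContinuousOn (fun r => Real.exp (-(radialInvVar n r * ‖x‖ ^ 2))) (Ioi 1) :=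
  (((continuousOn_radialInvVar n).mul continuousOn_const).neg).rexp

theorem integrableOn_densityIntegrand {n : ℕ} (hn : 1 ≤ n) (x : ℂ) :
    IntegrableOn (densityIntegrand n x) (Ioi 1) := by
  -- For `1 ≤ n` and `1 < r`, $n(r-1)+1\le nr$ and $r^{n+2}\ge r^3$.
  refine integrableOn_Ioi_of_le_inv_sq (c := n) ?_ fun r hr => ?_
  · refine ContinuousOn.mul (ContinuousOn.div (by fun_prop) (by fun_prop)
      fun r hr => pow_ne_zero _ (one_pos.trans hr).ne') (continuousOn_exp_radialInvVar n x)
  · have hr0 : (0 : ℝ) < r := one_pos.trans hr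
    have hn1 : (1 : ℝ) ≤ n := by exact_mod_cast hn
    have h1 : 0 ≤ (n : ℝ) * (r - 1) + 1 := by nlinarith
    have hexp : densityIntegrand n x r = (n * (r - 1) + 1) / r ^ (n + 2) *
      Real.exp (-(radialInvVar n r * ‖x‖ ^ 2)) := rfl
    rw [hexp, abs_of_nonneg (by positivity)]
    calc _ ≤ (n * (r - 1) + 1) / r ^ (n + 2) * 1 := by
          gcongr; exact exp_radialInvVar_le_one hr.le x
      _ ≤ (n * r) / r ^ (1 + 2) * 1 := by
          gcongr
          · linarith
          · exact hr.le
      _ = n / r ^ 2 := by field_simp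

theorem integrableOn_radialDensity {n : ℕ} (hn : 1 ≤ n) (x : ℂ) :
    IntegrableOn (radialDensity n x) (Ioi 1) := by
  have hn1 : (1 : ℝ) ≤ n := by exact_mod_cast hn
  have hn2 : (0 : ℝ) ≤ n - 1 := by linarith
  refine integrableOn_Ioi_of_le_inv_sq (c := 2 + n * (n - 1) * ‖x‖ ^ 2) ?_ fun r hr => ?_
  · refine ContinuousOn.mul (continuousOn_exp_radialInvVar n x) (ContinuousOn.add
      (ContinuousOn.div (by fun_prop) (by fun_prop)
        fun r hr => pow_ne_zero _ (one_pos.trans hr).ne')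
      (ContinuousOn.div (by fun_prop) (by fun_prop)
        fun r hr => pow_ne_zero _ (one_pos.trans hr).ne'))
  · have hr0 : (0 : ℝ) < r := one_pos.trans hr
    have hr1 : 0 ≤ r - 1 := by linarith
    rw [radialDensity, abs_of_nonneg (by positivity), add_div]
    calc _ ≤ 1 * (2 / r ^ (0 + 2) + n * (n - 1) * r ^ 2 * ‖x‖ ^ 2 / r ^ (2 * 1 + 2)) := by
          gcongr
          · exact exp_radialInvVar_le_one hr.le x
          · exact hr.le
          · omega
          · linarith
          · exact hr.le
      _ = _ := by field_simp; ring

/-- There are no boundary terms: the primitive has the factor $r-1$ at $1$ and is $O(1/r)$ at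
infinity. -/
theorem integral_radialDensity {n : ℕ} (hn : 1 ≤ n) (x : ℂ) :
    ∫ r in Ioi 1, radialDensity n x r = ∫ r in Ioi 1, densityIntegrand n x r := by
  have hI := integrableOn_densityIntegrand hn x
  have hH := integrableOn_radialDensity hn x
  have hlim : Filter.Tendsto (radialPrimitive n x) Filter.atTop (𝓝 0) := by
    refine squeeze_zero_norm' ?_ tendsto_inv_atTop_zero
    filter_upwards [Filter.eventually_gt_atTop 1] with r hr
    have hr0 : (0 : ℝ) < r := one_pos.trans hr
    have hr1 : 0 ≤ r - 1 := by linarith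
    rw [radialPrimitive, norm_mul, norm_neg, Real.norm_of_nonneg (by positivity),
      Real.norm_of_nonneg (by positivity)]
    calc _ ≤ r / r ^ (1 + 1) * 1 := by
          gcongr
          · linarith
          · exact hr.le
          · exact exp_radialInvVar_le_one hr.le x
      _ = r⁻¹ := by field_simp
  have h := integral_Ioi_of_hasDerivAt_of_tendsto
    (hasDerivAt_radialPrimitive n x one_pos).continuousAt.continuousWithinAt
    (fun r hr => hasDerivAt_radialPrimitive n x (one_pos.trans hr)) (hI.sub hH) hlim
  rw [integral_sub hI hH] at h
  have h1 : radialPrimitive n x 1 = 0 := by simp [radialPrimitive]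
  rw [h1, sub_zero, sub_eq_zero] at h
  exact h.symm

theorem image_one_add_sq_Ioi : (fun y : ℝ => 1 + y ^ 2) '' Ioi 0 = Ioi 1 := by
  ext r
  constructor
  · rintro ⟨y, hy, rfl⟩
    have : 0 < y ^ 2 := pow_pos hy 2
    simpa using this
  · intro hr
    have hr' : 0 < r - 1 := sub_pos.2 hr
    refine ⟨Real.sqrt (r - 1), Real.sqrt_pos.2 hr', ?_⟩
    simp [Real.sq_sqrt hr'.le]

/-- Integration in polar coordinates followed by the substitution `r = 1 + |z|²`. -/
theorem integrable_and_integral_one_add_sq_norm {f : ℝ → ℝ} (hf : IntegrableOn f (Ioi 1)) :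
    Integrable (fun z : ℂ => f (1 + ‖z‖ ^ 2)) ∧
      ∫ z : ℂ, f (1 + ‖z‖ ^ 2) = Real.pi * ∫ r in Ioi 1, f r := by
  have hd : ∀ y ∈ Ioi (0 : ℝ), HasDerivWithinAt (fun y : ℝ => 1 + y ^ 2) (2 * y) (Ioi 0) y :=
    fun y _ => by simpa using ((hasDerivAt_pow 2 y).const_add 1).hasDerivWithinAt
  have hinj : InjOn (fun y : ℝ => 1 + y ^ 2) (Ioi 0) := by
    intro y hy w hw h
    simp only [add_right_inj] at h
    exact (pow_left_inj₀ (le_of_lt hy) (le_of_lt hw) two_ne_zero).1 h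
  have hball : (volume : Measure ℂ).real (Metric.ball 0 1) = Real.pi := by
    simp [measureReal_def, Complex.volume_ball]
  have h1 := integrableOn_image_iff_integrableOn_abs_deriv_smul measurableSet_Ioi hd hinj f
  have h2 := integral_image_eq_integral_abs_deriv_smul measurableSet_Ioi hd hinj f
  rw [image_one_add_sq_Ioi] at h1 h2
  have habs : ∀ y ∈ Ioi (0 : ℝ), |2 * y| • f (1 + y ^ 2) = 2 * (y * f (1 + y ^ 2)) :=
    fun y hy => by
      rw [abs_of_pos (mul_pos two_pos hy), smul_eq_mul, mul_assoc]
  rw [setIntegral_congr_fun measurableSet_Ioi habs, integral_const_mul] at h2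
  have h1' := (integrableOn_congr_fun habs measurableSet_Ioi).1 (h1.1 hf)
  constructor
  · refine (integrable_fun_norm_addHaar (volume : Measure ℂ) (f := fun y => f (1 + y ^ 2))).2 ?_
    refine (h1'.const_mul (1 / 2)).congr (.of_forall fun y => ?_)
    simp [Complex.finrank_real_complex]
  · rw [integral_fun_norm_addHaar (volume : Measure ℂ) (fun y => f (1 + y ^ 2)), hball, h2]
    simp only [Complex.finrank_real_complex, smul_eq_mul, nsmul_eq_mul, Nat.cast_ofNat,
      Nat.add_one_sub_one, pow_one]
    ring

end Radial

/-! ### The expected measure and the conclusion -/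

section ExpectedMeasure

variable {n : ℕ}

theorem critDensity_nonneg (hn : 1 ≤ n) (z x : ℂ) : 0 ≤ critDensity n z x := by
  have hn2 : (0 : ℝ) ≤ n - 1 := sub_nonneg.2 (by exact_mod_cast hn)
  unfold critDensity; positivity

theorem continuous_critDensity (n : ℕ) : Continuous fun y : ℂ × ℂ => critDensity n y.1 y.2 := by
  have h : ∀ (y : ℂ × ℂ) (k : ℕ), (1 + ‖y.1‖ ^ 2) ^ k ≠ 0 := fun y k => by positivity
  simp only [critDensity, invVar]
  fun_prop (disch := exact fun y => h y _)

theorem densityFormula_nonneg (hn : 1 ≤ n) (x : ℂ) : 0 ≤ densityFormula n x := by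
  have hn2 : (0 : ℝ) ≤ n - 1 := sub_nonneg.2 (by exact_mod_cast hn)
  refine mul_nonneg (by positivity) (setIntegral_nonneg measurableSet_Ioi fun r hr => ?_)
  have hr0 : (0 : ℝ) < r := one_pos.trans hr
  have hr1 : 0 ≤ r - 1 := sub_nonneg.2 (le_of_lt hr)
  unfold densityIntegrand; positivity

theorem lintegral_critDensity (hn : 1 ≤ n) (x : ℂ) :
    ∫⁻ z, ENNReal.ofReal (critDensity n z x) = ENNReal.ofReal (densityFormula n x) := by
  obtain ⟨hint, hval⟩ :=
    integrable_and_integral_one_add_sq_norm (integrableOn_radialDensity hn x)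
  rw [← ofReal_integral_eq_lintegral_ofReal _ (.of_forall fun z => critDensity_nonneg hn z x)]
  · simp_rw [critDensity_eq_radialDensity]
    rw [integral_const_mul, hval, integral_radialDensity hn, densityFormula]
    congr 1
    field_simp
  · simp_rw [critDensity_eq_radialDensity]
    exact hint.const_mul _

theorem measurable_densityFormula (hn : 1 ≤ n) : Measurable (densityFormula n) := by
  have h : densityFormula n = fun x => (∫⁻ z, ENNReal.ofReal (critDensity n z x)).toReal := by
    ext x
    rw [lintegral_critDensity hn, ENNReal.toReal_ofReal (densityFormula_nonneg hn x)]
  rw [h]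
  exact ((continuous_critDensity n).comp continuous_swap).measurable.ennreal_ofReal
    |>.lintegral_prod_right.ennreal_toReal

/-- The kernel sending a coefficient vector to the empirical measure of critical values. -/
noncomputable def critKernel (n : ℕ) : Kernel (Fin (n + 1) → ℂ) ℂ :=
  ⟨critMeasure n, measurable_critMeasure⟩

instance : IsFiniteKernel (critKernel n) :=
  ⟨⟨n, ENNReal.natCast_lt_top n, critMeasure_univ_le⟩⟩

/-- The expected empirical measure of critical values has density `densityFormula`. -/
theorem snd_compProd_critKernel (hn : 1 ≤ n) :
    (Measure.pi (fun _ : Fin (n + 1) => stdComplexGaussian) ⊗ₘ critKernel n).snd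
      = volume.withDensity fun x => ENNReal.ofReal (densityFormula n x) := by
  ext B hB
  rw [Measure.snd_compProd, Measure.bind_apply hB (critKernel n).aemeasurable,
    withDensity_apply _ hB]
  refine (lintegral_critMeasure_apply hn hB).trans ?_
  rw [lintegral_lintegral_swap]
  · simp_rw [lintegral_critDensity hn]
  · exact (continuous_critDensity n).measurable.ennreal_ofReal.aemeasurable

theorem integrable_densityFormula (hn : 1 ≤ n) : Integrable (densityFormula n) := by
  -- The total mass is that of the expected empirical measure, finite because the kernel is bounded
  -- by `n`.
  refine ⟨(measurable_densityFormula hn).aestronglyMeasurable, ?_⟩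
  rw [hasFiniteIntegral_iff_ofReal (.of_forall (densityFormula_nonneg hn)), ← setLIntegral_univ,
    ← withDensity_apply _ MeasurableSet.univ, ← snd_compProd_critKernel hn]
  exact measure_lt_top _ _

theorem integrable_and_integral_critMeasure (hn : 1 ≤ n) {φ : ℂ → ℂ} (hφ : Continuous φ)
    (hc : HasCompactSupport φ) :
    Integrable (fun a => ∫ x, φ x ∂critMeasure n a)
        (Measure.pi (fun _ : Fin (n + 1) => stdComplexGaussian)) ∧
      ∫ a, ∫ x, φ x ∂critMeasure n a ∂Measure.pi (fun _ : Fin (n + 1) => stdComplexGaussian)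
        = ∫ x, φ x * (densityFormula n x : ℂ) := by
  obtain ⟨M, hM⟩ := hc.exists_bound_of_continuous hφ
  have hint : Integrable (fun y : (Fin (n + 1) → ℂ) × ℂ => φ y.2)
      (Measure.pi (fun _ : Fin (n + 1) => stdComplexGaussian) ⊗ₘ critKernel n) :=
    Integrable.of_bound (hφ.comp continuous_snd).aestronglyMeasurable M (.of_forall fun y => hM _)
  refine ⟨Integrable.integral_compProd (a := ())
    (κ := Kernel.const Unit (Measure.pi fun _ : Fin (n + 1) => stdComplexGaussian))
    (η := Kernel.prodMkLeft Unit (critKernel n)) hint, (Measure.integral_compProd hint).symm.trans ?_⟩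
  rw [← integral_map (φ := Prod.snd) (by fun_prop) hφ.aestronglyMeasurable]
  change ∫ y, φ y ∂Measure.snd _ = _
  rw [snd_compProd_critKernel hn, integral_withDensity_eq_integral_toReal_smul
    (measurable_densityFormula hn).ennreal_ofReal (by simp)]
  refine integral_congr_ae (.of_forall fun x => ?_)
  simp only [ENNReal.toReal_ofReal (densityFormula_nonneg hn x), Complex.real_smul, mul_comm]

end ExpectedMeasure

theorem isExpectedDensity_densityFormula {Ω : Type*} [MeasurableSpace Ω] {P : Measure Ω}
    {n : ℕ} (hn : 1 ≤ n) {a : Fin (n + 1) → Ω → ℂ}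
    (h : HasLaw (fun ω j => a j ω) (Measure.pi fun _ => stdComplexGaussian) P) :
    IsExpectedDensity P (fun ω => poly n (fun j => a j ω)) (densityFormula n) := by
  refine ⟨(integrable_densityFormula hn).locallyIntegrable, fun φ hφ hc => ?_⟩
  obtain ⟨h1, h2⟩ := integrable_and_integral_critMeasure hn hφ.continuous hc
  have hae := ae_nondegenerate hn
  rw [← h.map_eq] at hae h1 h2
  have hpair : (fun ω => pairing (poly n fun j => a j ω) φ)
      =ᵐ[P] fun ω => ∫ x, φ x ∂critMeasure n fun j => a j ω := by
    -- Outside a null event all critical points are nondegenerate, and there the two empirical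
    -- measures coincide.
    filter_upwards [ae_of_ae_map h.aemeasurable hae] with ω hω
    rw [pairing, critMeasure_eq_criticalValueMeasure hω]
  refine ⟨(integrable_congr hpair).2 (h1.comp_aemeasurable h.aemeasurable), ?_⟩
  rw [integral_congr_ae hpair, ← h2, integral_map h.aemeasurable h1.aestronglyMeasurable]

/-- The expected density is unique up to almost everywhere equality. -/
theorem IsExpectedDensity.ae_eq {Ω : Type*} [MeasurableSpace Ω] {P : Measure Ω} {p : Ω → ℂ[X]}
    {D D' : ℂ → ℝ} (h : IsExpectedDensity P p D) (h' : IsExpectedDensity P p D') :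
    ∀ᵐ x ∂(volume : Measure ℂ), D x = D' x := by
  refine ae_eq_of_integral_contDiff_smul_eq h.1 h'.1 fun g hg hc => ?_
  have hg' : ContDiff ℝ (⊤ : ℕ∞) fun x => (g x : ℂ) := Complex.ofRealCLM.contDiff.comp hg
  have hc' : HasCompactSupport fun x => (g x : ℂ) := hc.comp_left Complex.ofReal_zero
  have e := ((h.2 _ hg' hc').2.symm.trans (h'.2 _ hg' hc').2)
  simp only [← Complex.ofReal_mul, integral_complex_ofReal] at e
  exact_mod_cast e

end SU2

theorem proposition3p1 {Ω : Type*} [MeasurableSpace Ω] (P : Measure Ω) [IsProbabilityMeasure P]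
    (n : ℕ) (hn : 1 ≤ n) (a : Fin (n + 1) → Ω → ℂ)
    (hlaw : ∀ j, HasLaw (a j) SU2.stdComplexGaussian P) (hindep : iIndepFun a P) :
    (∀ x : ℂ, IntegrableOn (SU2.densityIntegrand n x) (Set.Ioi (1 : ℝ)) volume) ∧
    SU2.IsExpectedDensity P (fun ω => SU2.poly n (fun j => a j ω)) (SU2.densityFormula n) ∧
    (∀ D : ℂ → ℝ, SU2.IsExpectedDensity P (fun ω => SU2.poly n (fun j => a j ω)) D →
      ∀ᵐ x ∂(volume : Measure ℂ), D x = SU2.densityFormula n x) ∧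
    (∃ ρ : ℝ → ℝ, ∀ x : ℂ, SU2.densityFormula n x = ρ ‖x‖) := by
  have h := SU2.isExpectedDensity_densityFormula hn (hindep.hasLaw_pi hlaw)
  refine ⟨SU2.integrableOn_densityIntegrand hn, h, fun D hD => hD.ae_eq h,
    -- The radial profile is the restriction of the density to the real line.
    fun t => SU2.densityFormula n t, fun x => ?_⟩
  simp [SU2.densityFormula, SU2.densityIntegrand]
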